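/- Let $p$ be an odd prime, fix an algebraic closure $\overline{\mathbb Q}_p$ of $\mathbb Q_p$ with the absolute value $|\cdot|_p$ extending the $p$-adic one, and let $K\subseteq\overline{\mathbb Q}_p$ be a finite extension of $\mathbb Q_p$ with ring of integers $O_K$, maximal ideal $\mathfrak p_K$ and residue degree $f$ over $\mathbb F_p$. For a generator $\pi$ of $\mathfrak p_K$, a *$\pi$-unramified group law* over $O_K$ is a one-dimensional commutative formal group law $\mathfrak F$ over $O_K$ with a formal $R$-module structure $a\mapsto[a](X)=aX+\cdots\in O_K[[X]]$, where $R$ is the ring of integers of $\mathbb Q_p(\pi)$. It has *height* $h$, for an integer $h\ge1$, if, writing $[\pi](X)=\pi X+a_2X^2+a_3X^3+\cdots$, one has $\min\{i\ge2: |a_i|_p=1\}=p^h$. Let $\mathfrak F[\pi]$ be the set of all $z\in\overline{\mathbb Q}_p$ with $|z|_p<1$ and $[\pi](z)=0$, and let $K(\mathfrak F[\pi])$ be the field it generates over $K$. Let $\pi_1,\pi_2$ be generators of $\mathfrak p_K$, and for $i=1,2$ let $\mathfrak F_i$ be a $\pi_i$-unramified group law over $O_K$, both of the same height $h$, where $h\mid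 f$. Put $q=p^h$. For $i=1,2$ there are pairs $(\Pi_i,\pi_i')$ such that $\Pi_i$ is a generator of the maximal ideal of the ring of integers of $K(\mathfrak F_i[\pi_i])$, $\pi_i'$ is a generator of $\mathfrak p_K$, $\Pi_i^{q-1}=\pi_i'$ and $K(\Pi_i)=K(\mathfrak F_i[\pi_i])$. For every choice of such pairs, every $\zeta\in\overline{\mathbb Q}_p$ with $\zeta^{p^f-1}=1$ and $\left|\frac{\pi_2'}{\pi_1'}-\zeta\right|_p<1$, and every $\zeta_1\in\overline{\mathbb Q}_p$ with $\zeta_1^{q-1}=\zeta$: 1. $K(\mathfrak F_1[\pi_1],\mathfrak F_2[\pi_2])=K(\Pi_1,\Pi_2)=K(\zeta_1,\Pi_1)=K(\zeta_1,\Pi_2)$; 2. $K(\zeta_1)/K$ is the maximal unramified subextension of $K(\mathfrak F_1[\pi_1],\mathfrak F_2[\pi_2])/K$, that is, $K(\zeta_1)$ is contained in that field, is unramified over $K$, and contains every intermediate field that is unramified over $K$. -/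

import Mathlib

noncomputable section

open IsLocalRing

namespace PadicTorsion

/-! ### Valuations, rings of integers, residue degrees, unramified extensions

All fields in play are subfields of the fixed algebraic closure `PadicAlgCl p` of `ℚ_[p]`, which
carries the unique extension of the `p`-adic absolute value. -/

section Integers

variable (p : ℕ) [Fact p.Prime]

/-- The restriction to `L` of the absolute value of `PadicAlgCl p`. -/
def val (L : Type*) [Field L] [Algebra L (PadicAlgCl p)] : Valuation L NNReal :=
  (Valued.v : Valuation (PadicAlgCl p) NNReal).comap (algebraMap L (PadicAlgCl p))

/-- The ring of integers `O_L = {x ∈ L | |x| ≤ 1}`. It is a local ring; its maximal ideal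
`maximalIdeal (O p L)` is `𝔭_L`. -/
abbrev O (L : Type*) [Field L] [Algebra L (PadicAlgCl p)] : ValuationSubring L :=
  (val p L).valuationSubring

/-- An element of `L` seen in `PadicAlgCl p`. -/
abbrev toC {L : Type*} [Field L] [Algebra L (PadicAlgCl p)] (x : L) : PadicAlgCl p :=
  algebraMap L (PadicAlgCl p) x

theorem mem_O_iff {L : Type*} [Field L] [Algebra L (PadicAlgCl p)] (x : L) :
    x ∈ O p L ↔ ‖toC p x‖ ≤ 1 := Iff.rfl

/-- For a tower `L / K` of subfields of `PadicAlgCl p` the absolute value of `L` extends that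
of `K`. Hence `O_L` is an `O_K`-algebra, and the residue field of `L` an algebra over that
of `K`. -/
instance hasExtension (K L : Type*) [Field K] [Field L] [Algebra K (PadicAlgCl p)]
    [Algebra L (PadicAlgCl p)] [Algebra K L] [IsScalarTower K L (PadicAlgCl p)] :
    (val p K).HasExtension (val p L) where
  val_isEquiv_comap := by
    intro x y
    simp only [val, Valuation.comap_apply, ← IsScalarTower.algebraMap_apply]

/-- The degree of the extension of residue fields of `L / K`. -/
def residueDegree (K L : Type*) [Field K] [Field L] [Algebra K (PadicAlgCl p)]
    [Algebra L (PadicAlgCl p)] [Algebra K L] [IsScalarTower K L (PadicAlgCl p)] : ℕ :=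
  Module.finrank (ResidueField (O p K)) (ResidueField (O p L))

/-- `L / K` is unramified: `𝔭_K O_L = 𝔭_L`. (For finite extensions of `ℚ_[p]` the residue fields
are finite, so that the residue extension is automatically separable.) -/
def IsUnramifiedExt (K L : Type*) [Field K] [Field L] [Algebra K (PadicAlgCl p)]
    [Algebra L (PadicAlgCl p)] [Algebra K L] [IsScalarTower K L (PadicAlgCl p)] : Prop :=
  (maximalIdeal (O p K)).map (algebraMap (O p K) (O p L)) = maximalIdeal (O p L)

/-- `x` is a generator of the maximal ideal of `O_L`. -/
def IsGenerator {L : Type*} [Field L] [Algebra L (PadicAlgCl p)] (x : O p L) : Prop :=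
  maximalIdeal (O p L) = Ideal.span {x}

end Integers

/-! ### Formal modules -/

/-- A formal `R`-module structure on a formal group law `F` over an `R`-algebra `A`: a ring
homomorphism `a ↦ [a](X)` from `R` to the ring of endomorphisms of `F` over `A` (with addition
`f +_F g = F(f, g)` and multiplication given by composition) such that `[a](X) = a X + ⋯`. -/
structure FormalModuleStructure (R : Type*) [CommRing R] {A : Type*} [CommRing A] [Algebra R A]
    (F : FormalGroup A) where
  /-- the power series `[a](X)` -/
  act : R → PowerSeries A
  constantCoeff_act : ∀ a, PowerSeries.constantCoeff (act a) = 0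
  coeff_one_act : ∀ a, PowerSeries.coeff 1 (act a) = algebraMap R A a
  /-- `F([a](X), [a](Y)) = [a](F(X, Y))` -/
  act_hom : ∀ a,
    F.toPowerSeries.subst
        ![(act a).subst (MvPowerSeries.X 0 : MvPowerSeries (Fin 2) A),
          (act a).subst (MvPowerSeries.X 1 : MvPowerSeries (Fin 2) A)] =
      (act a).subst F.toPowerSeries
  act_one : act 1 = PowerSeries.X
  /-- `[a + b](X) = F([a](X), [b](X))` -/
  act_add : ∀ a b, act (a + b) = F.toPowerSeries.subst ![act a, act b]
  /-- `[a b](X) = [a]([b](X))` -/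
  act_mul : ∀ a b, act (a * b) = (act a).subst (act b)

/-! ### Unramified group laws over `O_K` and their division points -/

section Unramified

variable (p : ℕ) [Fact p.Prime] (K : IntermediateField ℚ_[p] (PadicAlgCl p))

/-- The subfield `ℚ_[p](π)` of `K`. -/
abbrev subfieldOf (π : O p K) : IntermediateField ℚ_[p] K :=
  IntermediateField.adjoin ℚ_[p] {(π : K)}

/-- The element `π` of the ring of integers `R` of `ℚ_[p](π)`. -/
def genIn (π : O p K) : O p (subfieldOf p K π) :=
  ⟨⟨π, IntermediateField.mem_adjoin_simple_self ℚ_[p] (π : K)⟩, π.2⟩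

/-- A `π`-unramified group law over `O_K`: a commutative one-dimensional formal group law over
`O_K` with a formal module structure over the ring of integers of `ℚ_[p](π)`. -/
structure UnramifiedGroupLaw (π : O p K) where
  /-- the formal group law -/
  law : FormalGroup (O p K)
  isComm : law.IsComm
  /-- the formal `R`-module structure -/
  module : FormalModuleStructure (O p (subfieldOf p K π)) law

variable {p K}

/-- The power series `[π](X) ∈ O_K⟦X⟧`. -/
def UnramifiedGroupLaw.mulPi {π : O p K} (F : UnramifiedGroupLaw p K π) : PowerSeries (O p K) :=
  F.module.act (genIn p K π)

/-- `F` has height `h`: `h > 0`, and `p ^ h` is the least `i ≥ 2` for which the coefficient of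
`X ^ i` in `[π](X)` has absolute value `1`. -/
def UnramifiedGroupLaw.HasHeight {π : O p K} (F : UnramifiedGroupLaw p K π) (h : ℕ) : Prop :=
  0 < h ∧
    IsLeast {i : ℕ | 2 ≤ i ∧ ‖toC p ((PowerSeries.coeff i F.mulPi : O p K) : K)‖ = 1} (p ^ h)

/-- The division points `F[π]`: all `z` in the maximal ideal of the ring of integers of
`PadicAlgCl p` such that the (convergent) series `[π](z)` has the value `0`. -/
def UnramifiedGroupLaw.torsion {π : O p K} (F : UnramifiedGroupLaw p K π) :
    Set (PadicAlgCl p) :=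
  {z | ‖z‖ < 1 ∧ HasSum (fun n : ℕ => toC p ((PowerSeries.coeff n F.mulPi : O p K) : K) * z ^ n) 0}

/-- `(Π, π')` is an admissible pair for `F` and `q`: with `M = K(F[π])`, `Π` generates `𝔭_M`,
`π'` generates `𝔭_K`, `Π ^ (q - 1) = π'` and `K(Π) = M`. -/
structure UnramifiedGroupLaw.IsAdmissiblePair {π : O p K} (F : UnramifiedGroupLaw p K π) (q : ℕ)
    (P : PadicAlgCl p) (π' : O p K) : Prop where
  generator_top : ∃ x : O p (IntermediateField.adjoin K F.torsion),
    toC p (x : IntermediateField.adjoin K F.torsion) = P ∧ IsGenerator p x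
  generator_base : IsGenerator p π'
  pow_eq : P ^ (q - 1) = toC p (π' : K)
  adjoin_eq : IntermediateField.adjoin K {P} = IntermediateField.adjoin K F.torsion

end Unramified

end PadicTorsion

end

noncomputable section

open IsLocalRing Polynomial

namespace PadicTorsion

variable {p : ℕ} [Fact p.Prime]

/-! Put n = q - 1, which is prime to p. Weierstrass preparation writes [π](X) as X g(X) times a unit
series, with g Eisenstein of degree n, so the division points are 0 and the roots of g
(`exists_eisenstein`). For a root z, K(z)/K is totally and tamely ramified: z^n/π is congruent to
some c in K, and Hensel's lemma makes z^n/(πc) an n-th power w^n in K(z). Then P = z/w satisfies P^n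
= πc and generates K(z) (`exists_radical_generator`). Since h ∣ f, K contains the n-th roots of
unity, so K(P) is normal and contains every root of g. This gives the admissible pairs.

For two pairs, π₂'/(π₁'ζ) is congruent to 1, hence an n-th power in K, so P₂ = k ζ₁ P₁ with k in K
(`exists_eq_mul_mul`). The equalities of fields follow.

For maximality (`isGreatest_unramified`), ζ₁ is a root of unity of order prime to p, so K(ζ₁) has
the value group of K. Adjoining P₁ to K(ζ₁) is totally ramified and creates no residue classes. An
unramified L inside the compositum therefore has all its residue classes represented in K(ζ₁). Roots
of unity represent these classes in the intersection, and π-adic approximation together with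
completeness of K(ζ₁) gives L ≤ K(ζ₁). -/

instance isScalarTower_intermediateField (K : IntermediateField ℚ_[p] (PadicAlgCl p))
    (L : IntermediateField K (PadicAlgCl p)) : IsScalarTower ℚ_[p] L (PadicAlgCl p) :=
  IsScalarTower.of_algebraMap_eq fun _ => rfl

/-! ### Compatibility of the embedding with field operations -/

section toC

variable {E : Type*} [Field E] [Algebra E (PadicAlgCl p)]

theorem toC_zero : toC p (0 : E) = 0 := map_zero _

theorem toC_sub (x y : E) : toC p (x - y) = toC p x - toC p y := map_sub _ _ _

theorem toC_mul (x y : E) : toC p (x * y) = toC p x * toC p y := map_mul _ _ _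

theorem toC_inv (x : E) : toC p x⁻¹ = (toC p x)⁻¹ := map_inv₀ _ _

theorem toC_div (x y : E) : toC p (x / y) = toC p x / toC p y := map_div₀ _ _ _

theorem toC_pow (x : E) (n : ℕ) : toC p (x ^ n) = toC p x ^ n := map_pow _ _ _

theorem toC_zpow (x : E) (n : ℤ) : toC p (x ^ n) = toC p x ^ n := map_zpow₀ _ _ _

theorem toC_injective : Function.Injective (toC p : E → PadicAlgCl p) :=
  (algebraMap E (PadicAlgCl p)).injective

theorem toC_ne_zero {x : E} (hx : x ≠ 0) : toC p x ≠ 0 := (_root_.map_ne_zero _).2 hx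

end toC

/-! ### Roots of unity in `PadicAlgCl p` -/

theorem norm_natCast_eq_one {m : ℕ} (hm : ¬ p ∣ m) : ‖(m : PadicAlgCl p)‖ = 1 := by
  rw [← map_natCast (algebraMap ℚ_[p] (PadicAlgCl p)), PadicAlgCl.norm_extends]
  exact (Padic.norm_natCast_eq_one_iff).2 ((Nat.Prime.coprime_iff_not_dvd Fact.out).2 hm)

theorem norm_eq_one_of_pow_eq_one {m : ℕ} (hm : m ≠ 0) {x : PadicAlgCl p} (hx : x ^ m = 1) :
    ‖x‖ = 1 := by
  have h : ‖x‖ ^ m = 1 := by rw [← norm_pow, hx, norm_one]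
  exact (pow_eq_one_iff_of_nonneg (norm_nonneg x) hm).1 h

theorem norm_eq_one_of_norm_sub_lt {x y : PadicAlgCl p} (hy : ‖y‖ = 1) (h : ‖x - y‖ < 1) :
    ‖x‖ = 1 := by
  have := IsUltrametricDist.norm_add_eq_max_of_norm_ne_norm (x := x - y) (y := y)
    (by rw [hy]; exact h.ne)
  rw [sub_add_cancel, hy, max_eq_right h.le] at this
  exact this

theorem norm_sub_le_max (x y : PadicAlgCl p) : ‖x - y‖ ≤ max ‖x‖ ‖y‖ := by
  rw [sub_eq_add_neg, ← norm_neg y]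
  exact IsUltrametricDist.norm_add_le_max _ _

theorem norm_sub_lt_of_lt {x y z : PadicAlgCl p} {r : ℝ} (h₁ : ‖x - y‖ < r) (h₂ : ‖y - z‖ < r) :
    ‖x - z‖ < r := by
  rw [← sub_add_sub_cancel x y z]
  exact (IsUltrametricDist.norm_add_le_max _ _).trans_lt (max_lt h₁ h₂)

theorem norm_pow_sub_pow_lt {x y : PadicAlgCl p} (hx : ‖x‖ ≤ 1) (hy : ‖y‖ ≤ 1)
    (h : ‖x - y‖ < 1) (m : ℕ) : ‖x ^ m - y ^ m‖ < 1 := by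
  induction m with
  | zero => simp
  | succ m ih =>
    have e : x ^ (m + 1) - y ^ (m + 1) = (x ^ m - y ^ m) * x + y ^ m * (x - y) := by ring
    rw [e]
    refine (IsUltrametricDist.norm_add_le_max _ _).trans_lt (max_lt ?_ ?_)
    · rw [norm_mul]
      exact (mul_le_of_le_one_right (norm_nonneg _) hx).trans_lt ih
    · rw [norm_mul, norm_pow]
      exact (mul_le_of_le_one_left (norm_nonneg _) (pow_le_one₀ (norm_nonneg _) hy)).trans_lt h

/-- A root of unity of order prime to `p` in the open unit disc around `1` is `1`. -/
theorem eq_one_of_pow_eq_one {m : ℕ} (hm : ¬ p ∣ m) {x : PadicAlgCl p} (hx : x ^ m = 1)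
    (h : ‖x - 1‖ < 1) : x = 1 := by
  have hm0 : m ≠ 0 := fun h0 => hm (h0 ▸ dvd_zero p)
  have hx1 : ‖x‖ = 1 := norm_eq_one_of_pow_eq_one hm0 hx
  -- In x^m - 1 = (x - 1) ∑ x^i every x^i is congruent to 1, so the sum is congruent to the unit m
  -- and cannot vanish.
  have hsum : ‖(∑ i ∈ Finset.range m, x ^ i) - m‖ < 1 := by
    have e : (∑ i ∈ Finset.range m, x ^ i) - (m : PadicAlgCl p) =
        ∑ i ∈ Finset.range m, (x ^ i - 1 ^ i) := by simp
    rw [e]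
    have : ∀ i ∈ Finset.range m, ‖x ^ i - 1 ^ i‖ < 1 := fun i _ =>
      norm_pow_sub_pow_lt hx1.le norm_one.le h i
    obtain ⟨i, hi, hle⟩ := IsUltrametricDist.exists_norm_finsetSum_le (Finset.range m)
      (fun i => x ^ i - 1 ^ i)
    exact hle.trans_lt (this i (hi (Finset.nonempty_range_iff.2 hm0)))
  have h1 := norm_eq_one_of_norm_sub_lt (norm_natCast_eq_one hm) hsum
  have h0 : (∑ i ∈ Finset.range m, x ^ i) * (x - 1) = 0 := by
    rw [geom_sum_mul, hx, sub_self]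
  rcases mul_eq_zero.1 h0 with h2 | h2
  · rw [h2, norm_zero] at h1
    exact absurd h1 zero_ne_one
  · exact sub_eq_zero.1 h2

/-- Two `m`-th roots of the same unit, `m` prime to `p`, in the same residue class coincide. -/
theorem eq_of_pow_eq_pow {m : ℕ} (hm : ¬ p ∣ m) {x y : PadicAlgCl p} (hy : ‖y‖ = 1)
    (hxy : x ^ m = y ^ m) (h : ‖x - y‖ < 1) : x = y := by
  have hy0 : y ≠ 0 := norm_ne_zero_iff.1 (hy ▸ one_ne_zero)
  have : x / y = 1 := by
    refine eq_one_of_pow_eq_one hm (by rw [div_pow, hxy, div_self (pow_ne_zero _ hy0)]) ?_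
    rw [div_sub_one hy0, norm_div, hy, div_one]
    exact h
  exact (div_eq_one_iff_eq hy0).1 this

/-! ### Galois action and Hensel's lemma -/

section Galois

variable {E : Type*} [Field E] [Algebra E (PadicAlgCl p)] [Algebra ℚ_[p] E]
  [IsScalarTower ℚ_[p] E (PadicAlgCl p)]

/-- The norm is the spectral norm over `ℚ_[p]`, which depends only on the minimal polynomial and so
is the same for conjugates. -/
theorem norm_algEquiv (σ : Gal(PadicAlgCl p/E)) (x : PadicAlgCl p) : ‖σ x‖ = ‖x‖ := by
  rw [← PadicAlgCl.spectralNorm_eq, ← PadicAlgCl.spectralNorm_eq]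
  exact (spectralNorm_eq_of_equiv (σ.restrictScalars ℚ_[p]) x).symm

variable (p E) in
theorem isGalois_padicAlgCl : IsGalois E (PadicAlgCl p) := by
  have : CharZero E := charZero_of_injective_algebraMap (algebraMap ℚ_[p] E).injective
  have : Algebra.IsAlgebraic E (PadicAlgCl p) := Algebra.IsAlgebraic.tower_top (K := ℚ_[p]) E
  have : IsAlgClosure E (PadicAlgCl p) := ⟨inferInstance, inferInstance⟩
  have : Normal E (PadicAlgCl p) := IsAlgClosure.normal E _
  exact ⟨⟩

theorem mem_range_of_forall_fixed {x : PadicAlgCl p} (hx : ∀ σ : Gal(PadicAlgCl p/E), σ x = x) :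
    ∃ y : E, toC p y = x := by
  have := isGalois_padicAlgCl p E
  exact IntermediateField.mem_bot.1 ((InfiniteGalois.mem_bot_iff_fixed x).2 hx)

theorem one_le_norm_multiset_prod {s : Multiset (PadicAlgCl p)} (hs : ∀ x ∈ s, 1 ≤ ‖x‖) :
    1 ≤ ‖s.prod‖ := by
  induction s using Multiset.induction_on with
  | empty => simp
  | cons a s ih =>
    rw [Multiset.prod_cons, norm_mul]
    exact one_le_mul_of_one_le_of_one_le (hs a (Multiset.mem_cons_self a s))
      (ih fun x hx => hs x (Multiset.mem_cons_of_mem hx))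

/-- Hensel's lemma for `X ^ m - b` with `m` prime to `p`. -/
theorem exists_pow_eq_of_norm_sub_lt {m : ℕ} (hm : ¬ p ∣ m) (a b : E) (ha : ‖toC p a‖ = 1)
    (hab : ‖toC p a ^ m - toC p b‖ < 1) :
    ∃ w : E, w ^ m = b ∧ ‖toC p w - toC p a‖ < 1 := by
  have hm0 : m ≠ 0 := fun h0 => hm (h0 ▸ dvd_zero p)
  set f : (PadicAlgCl p)[X] := X ^ m - C (toC p b) with hf
  have hmonic : f.Monic := monic_X_pow_sub_C _ hm0
  have hs : f.Splits := IsAlgClosed.splits f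
  have hev := hs.eval_eq_prod_roots (toC p a)
  rw [hmonic.leadingCoeff, one_mul] at hev
  -- The value f(a) is the product of a - w over the roots w; its norm is below 1, so some factor
  -- has norm below 1.
  have hex : ∃ w ∈ f.roots, ‖toC p a - w‖ < 1 := by
    by_contra! hcon
    have : (1 : ℝ) ≤ ‖(f.roots.map fun w => toC p a - w).prod‖ := by
      refine one_le_norm_multiset_prod fun x hx => ?_
      obtain ⟨w, hw, rfl⟩ := Multiset.mem_map.1 hx
      exact hcon w hw
    rw [← hev] at this
    simp only [hf, eval_sub, eval_pow, eval_X, eval_C] at this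
    exact absurd hab (not_lt.2 this)
  obtain ⟨w, hw, hwa⟩ := hex
  have hwb : w ^ m = toC p b := by
    have := (mem_roots hmonic.ne_zero).1 hw
    simpa [hf, IsRoot, sub_eq_zero] using this
  have hw1 : ‖w‖ = 1 := norm_eq_one_of_norm_sub_lt ha (by rwa [norm_sub_rev])
  -- σ is an isometry fixing a, so σ w is again a root in the residue class of a. That class
  -- contains only one root, so w is Galois-fixed and lies in E; no completeness of E is needed.
  obtain ⟨y, rfl⟩ := mem_range_of_forall_fixed (E := E) (x := w) fun σ => by
    refine eq_of_pow_eq_pow hm hw1 (by rw [← map_pow, hwb, AlgEquiv.commutes]) ?_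
    refine norm_sub_lt_of_lt (y := toC p a) ?_ hwa
    have e : σ (w - toC p a) = σ w - toC p a := by rw [map_sub, AlgEquiv.commutes]
    rw [← e, norm_algEquiv, norm_sub_rev]
    exact hwa
  refine ⟨y, toC_injective ((toC_pow y m).trans hwb), ?_⟩
  rwa [norm_sub_rev]

end Galois

/-! ### Generators of maximal ideals and value groups -/

section ValueGroup

variable {E : Type*} [Field E] [Algebra E (PadicAlgCl p)]

theorem isUnit_O_iff (y : O p E) : IsUnit y ↔ ‖toC p (y : E)‖ = 1 := by
  constructor
  · rintro ⟨u, rfl⟩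
    have h1 : ‖toC p ((u : O p E) : E)‖ ≤ 1 := (u : O p E).2
    have h2 : ‖toC p ((↑u⁻¹ : O p E) : E)‖ ≤ 1 := (↑u⁻¹ : O p E).2
    have h3 : ‖toC p ((u : O p E) : E)‖ * ‖toC p ((↑u⁻¹ : O p E) : E)‖ = 1 := by
      rw [← norm_mul, ← map_mul, ← MulMemClass.coe_mul, Units.mul_inv, OneMemClass.coe_one, map_one,
        norm_one]
    refine le_antisymm h1 ?_
    rw [← h3]
    exact mul_le_of_le_one_right (norm_nonneg _) h2
  · intro h
    have h0 : (y : E) ≠ 0 := fun h0 => by simp [h0] at h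
    refine IsUnit.of_mul_eq_one ⟨(y : E)⁻¹, ?_⟩ (Subtype.ext (mul_inv_cancel₀ h0))
    rw [mem_O_iff, toC_inv, norm_inv, h, inv_one]

theorem mem_maximalIdeal_O_iff (y : O p E) : y ∈ maximalIdeal (O p E) ↔ ‖toC p (y : E)‖ < 1 := by
  have hy : ‖toC p (y : E)‖ ≤ 1 := y.2
  rw [mem_maximalIdeal, _root_.mem_nonunits_iff, isUnit_O_iff, hy.lt_iff_ne]

/-- The ideal spanned by x is the ball of radius ‖x‖, so generating the maximal ideal means having
the largest norm below 1. Later arguments use this norm form. -/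
theorem isGenerator_iff (x : O p E) : IsGenerator p x ↔
    ‖toC p (x : E)‖ < 1 ∧ ∀ y : E, ‖toC p y‖ < 1 → ‖toC p y‖ ≤ ‖toC p (x : E)‖ := by
  constructor
  · intro h
    refine ⟨(mem_maximalIdeal_O_iff x).1 (h ▸ Ideal.mem_span_singleton_self x), fun y hy => ?_⟩
    have hm : (⟨y, hy.le⟩ : O p E) ∈ maximalIdeal (O p E) := (mem_maximalIdeal_O_iff _).2 hy
    rw [h, Ideal.mem_span_singleton'] at hm
    obtain ⟨a, ha⟩ := hm
    have : y = (a : E) * x := by rw [← MulMemClass.coe_mul, ha]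
    rw [this, toC_mul, norm_mul]
    exact mul_le_of_le_one_left (norm_nonneg _) a.2
  · rintro ⟨h1, h2⟩
    refine le_antisymm (fun y hy => ?_) ?_
    · have hle := h2 y ((mem_maximalIdeal_O_iff y).1 hy)
      rw [Ideal.mem_span_singleton']
      by_cases hx : (x : E) = 0
      · have hy0 : (y : E) = 0 := by
          rw [hx, toC_zero, norm_zero] at hle
          exact (map_eq_zero _).1 (norm_le_zero_iff.1 hle)
        exact ⟨0, Subtype.ext (by rw [MulMemClass.coe_mul, hx, mul_zero, hy0])⟩
      · refine ⟨⟨(y : E) / x, ?_⟩, Subtype.ext (div_mul_cancel₀ _ hx)⟩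
        rw [mem_O_iff, toC_div, norm_div]
        exact div_le_one_of_le₀ hle (norm_nonneg _)
    · rw [Ideal.span_singleton_le_iff_mem, mem_maximalIdeal_O_iff]
      exact h1

variable (p E) in
/-- The absolute value of every nonzero element of `E` is an integral power of `ρ`. -/
def HasValueGroup (ρ : ℝ) : Prop := ∀ y : E, y ≠ 0 → ∃ k : ℤ, ‖toC p y‖ = ρ ^ k

/-- The element p of E has norm strictly between 0 and 1, which excludes a zero generator. -/
theorem IsGenerator.norm_pos [Algebra ℚ_[p] E] [IsScalarTower ℚ_[p] E (PadicAlgCl p)]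
    {x : O p E} (hx : IsGenerator p x) : 0 < ‖toC p (x : E)‖ := by
  have h := ((isGenerator_iff x).1 hx).2 (algebraMap ℚ_[p] E p)
  have e : toC p (algebraMap ℚ_[p] E p) = algebraMap ℚ_[p] (PadicAlgCl p) p :=
    (IsScalarTower.algebraMap_apply _ _ _ _).symm
  rw [e, PadicAlgCl.norm_extends] at h
  have hp : (0 : ℝ) < ‖(p : ℚ_[p])‖ :=
    norm_pos_iff.2 (Nat.cast_ne_zero.2 (Nat.Prime.ne_zero Fact.out))
  exact hp.trans_le (h Padic.norm_p_lt_one)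

/-- A power of x moves y into the shell ‖x‖ < ‖·‖ ≤ 1, where maximality of ‖x‖ leaves only the norm
1. -/
theorem hasValueGroup_of_norm_le {x : E} (h0 : 0 < ‖toC p x‖) (h1 : ‖toC p x‖ < 1)
    (h : ∀ y : E, ‖toC p y‖ < 1 → ‖toC p y‖ ≤ ‖toC p x‖) : HasValueGroup p E ‖toC p x‖ := by
  intro y hy
  have hy0 : 0 < ‖toC p y‖ := norm_pos_iff.2 (toC_ne_zero hy)
  obtain ⟨n, hn1, hn2⟩ := exists_mem_Ioc_zpow hy0 ((one_lt_inv₀ h0).2 h1)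
  have hpos : 0 < ‖toC p x‖ ^ (n + 1) := zpow_pos h0 _
  have e : ‖toC p (y * x ^ (n + 1))‖ = ‖toC p y‖ * ‖toC p x‖ ^ (n + 1) := by
    rw [toC_mul, norm_mul, toC_zpow, norm_zpow]
  have hle : ‖toC p (y * x ^ (n + 1))‖ ≤ 1 := by
    rw [e, ← inv_mul_cancel₀ hpos.ne']
    rw [inv_zpow] at hn2
    exact mul_le_mul_of_nonneg_right hn2 hpos.le
  have hgt : ‖toC p x‖ < ‖toC p (y * x ^ (n + 1))‖ := by
    rw [e]
    have := mul_lt_mul_of_pos_right hn1 hpos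
    rwa [inv_zpow, zpow_add_one₀ h0.ne', inv_mul_cancel_left₀ (zpow_pos h0 _).ne',
      ← zpow_add_one₀ h0.ne'] at this
  have h2 : ‖toC p (y * x ^ (n + 1))‖ = 1 :=
    le_antisymm hle (not_lt.1 fun hlt => absurd (h _ hlt) (not_le.2 hgt))
  refine ⟨-(n + 1), ?_⟩
  rw [zpow_neg]
  exact eq_inv_of_mul_eq_one_left (e ▸ h2)

theorem IsGenerator.hasValueGroup [Algebra ℚ_[p] E] [IsScalarTower ℚ_[p] E (PadicAlgCl p)]
    {x : O p E} (hx : IsGenerator p x) : HasValueGroup p E ‖toC p (x : E)‖ :=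
  hasValueGroup_of_norm_le hx.norm_pos ((isGenerator_iff x).1 hx).1 ((isGenerator_iff x).1 hx).2

theorem HasValueGroup.norm_le {ρ : ℝ} (h : HasValueGroup p E ρ) (h0 : 0 < ρ) (h1 : ρ < 1) {y : E}
    (hy : ‖toC p y‖ < 1) : ‖toC p y‖ ≤ ρ := by
  by_cases hy0 : y = 0
  · rw [hy0, toC_zero, norm_zero]
    exact h0.le
  obtain ⟨k, hk⟩ := h y hy0
  have hk1 : 1 ≤ k := by
    by_contra! hlt
    have : (1 : ℝ) ≤ ρ ^ k := one_le_zpow_of_nonpos₀ h0 h1.le (by lia)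
    exact absurd hy (not_lt.2 (hk ▸ this))
  rw [hk]
  simpa using zpow_le_zpow_right_of_le_one₀ h0 h1.le hk1

end ValueGroup

/-! ### Totally ramified simple extensions -/

section TotallyRamified

variable {F : Type*} [Field F] [Algebra F (PadicAlgCl p)]

theorem exists_aeval_eq {P : PadicAlgCl p} {g : F[X]} (hg : g.Monic) (hg1 : 0 < g.natDegree)
    (hP : aeval P g = 0) {x : PadicAlgCl p} (hx : x ∈ IntermediateField.adjoin F {P}) :
    ∃ A : F[X], A.natDegree < g.natDegree ∧ aeval P A = x := by
  have hint : IsIntegral F P := ⟨g, hg, by rwa [← aeval_def]⟩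
  rw [← IntermediateField.mem_toSubalgebra,
    IntermediateField.adjoin_simple_toSubalgebra_of_isAlgebraic hint.isAlgebraic,
    Algebra.adjoin_singleton_eq_range_aeval] at hx
  obtain ⟨B, rfl⟩ := hx
  refine ⟨B %ₘ g, natDegree_modByMonic_lt B hg fun h => ?_, ?_⟩
  · rw [h, natDegree_one] at hg1
    exact lt_irrefl _ hg1
  · exact aeval_modByMonic_eq_self_of_root hP

/-- If `|P| ^ n` generates the value group of `F`, then `1, P, …, P ^ (n - 1)` are orthogonal. -/
theorem norm_coeff_mul_le_norm_aeval {ρ : ℝ} (hF : HasValueGroup p F ρ) (h0 : 0 < ρ) (h1 : ρ < 1)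
    {P : PadicAlgCl p} {n : ℕ} (hP : ‖P‖ ^ n = ρ) {A : F[X]} (hA : A.natDegree < n) (i : ℕ) :
    ‖toC p (A.coeff i)‖ * ‖P‖ ^ i ≤ ‖aeval P A‖ := by
  by_cases hA0 : A = 0
  · simp [hA0]
  have hn : n ≠ 0 := fun h => by simp [h] at hA
  have hP0 : 0 < ‖P‖ := by
    refine (norm_nonneg P).lt_of_ne fun h => ?_
    rw [← h, zero_pow hn] at hP
    exact h0.ne hP
  have hP1 : ‖P‖ < 1 := by
    by_contra! h
    exact absurd h1 (not_lt.2 (hP ▸ one_le_pow₀ h))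
  set f : ℕ → PadicAlgCl p := fun i => toC p (A.coeff i) * P ^ i with hf
  have hfn : ∀ i, ‖f i‖ = ‖toC p (A.coeff i)‖ * ‖P‖ ^ i := fun i => by
    rw [hf, norm_mul, norm_pow]
  -- As ρ = ‖P‖^n, the i-th term has norm ‖P‖^(nk + i) with 0 ≤ i < n. The exponent modulo n
  -- recovers i, so the nonzero terms have distinct norms and the largest one is the norm of the
  -- sum.
  have hinj : ∀ i ∈ A.support, ∀ j ∈ A.support, ‖f i‖ = ‖f j‖ → i = j := by
    intro i hi j hj hij
    obtain ⟨k, hk⟩ := hF _ (mem_support_iff.1 hi)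
    obtain ⟨l, hl⟩ := hF _ (mem_support_iff.1 hj)
    have hin : i < n := (le_natDegree_of_mem_supp i hi).trans_lt hA
    have hjn : j < n := (le_natDegree_of_mem_supp j hj).trans_lt hA
    rw [hfn, hfn, hk, hl, ← hP, ← zpow_natCast, ← zpow_natCast, ← zpow_natCast, ← zpow_mul,
      ← zpow_mul, ← zpow_add₀ hP0.ne', ← zpow_add₀ hP0.ne'] at hij
    have h2 := zpow_right_injective₀ hP0 hP1.ne hij
    have h3 : ((n : ℤ) * k + i) % n = (n * l + j) % n := by rw [h2]
    rw [Int.mul_add_emod_self_left, Int.mul_add_emod_self_left,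
      Int.emod_eq_of_lt (by lia) (by lia), Int.emod_eq_of_lt (by lia) (by lia)] at h3
    exact_mod_cast h3
  obtain ⟨j, hj, hmax⟩ := A.support.exists_max_image (fun i => ‖f i‖) (support_nonempty.2 hA0)
  have hsum : aeval P A = ∑ i ∈ A.support, f i := by
    rw [aeval_def, eval₂_eq_sum, sum_def]
  have hval : ‖aeval P A‖ = ‖f j‖ := by
    have := Valuation.map_sum_eq_of_lt (Valued.v : Valuation (PadicAlgCl p) NNReal)
      (s := A.support) (f := f) hj fun i hi => by
        rw [Finset.mem_sdiff, Finset.mem_singleton] at hi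
        have hlt : ‖f i‖ < ‖f j‖ :=
          (hmax i hi.1).lt_of_ne fun h => hi.2 (hinj i hi.1 j hj h)
        exact hlt
    rw [hsum]
    exact congrArg NNReal.toReal this
  rw [hval, ← hfn]
  by_cases hi : i ∈ A.support
  · exact hmax i hi
  · rw [hf]
    simpa [notMem_support_iff.1 hi] using mul_nonneg (norm_nonneg _) (pow_nonneg hP0.le _)

end TotallyRamified

/-! ### Adjoining roots of unity of order prime to `p` -/

section RootsOfUnity

/-- Interpolation at points of the closed unit disc with mutual distances `1`. -/
theorem norm_coeff_le_of_eval_le {r : ℝ} (hr : 0 ≤ r) (S : Finset (PadicAlgCl p))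
    (hS1 : ∀ s ∈ S, ‖s‖ ≤ 1) (hS : ∀ s ∈ S, ∀ t ∈ S, s ≠ t → ‖s - t‖ = 1)
    (A : (PadicAlgCl p)[X]) (hA : A.degree < S.card) (hr' : ∀ s ∈ S, ‖A.eval s‖ ≤ r) (i : ℕ) :
    ‖A.coeff i‖ ≤ r := by
  classical
  induction S using Finset.induction_on generalizing A i with
  | empty =>
    have : A = 0 := by simpa using hA
    simpa [this] using hr
  | insert s S hs ih =>
    -- Newton interpolation: the quotient takes the value (A(t) - A(s))/(t - s) at t, still bounded
    -- by r because ‖t - s‖ = 1, so induction applies to it.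
    have hdec : A = C (A.eval s) + (X - C s) * (A /ₘ (X - C s)) := by
      rw [← modByMonic_X_sub_C_eq_C_eval, modByMonic_add_div]
    set B := A /ₘ (X - C s) with hB
    have hBdeg : B.degree < S.card := by
      rw [Finset.card_insert_of_notMem hs] at hA
      by_cases hA0 : A = 0
      · rw [hB, hA0, zero_divByMonic, degree_zero]
        exact WithBot.bot_lt_coe _
      rw [← natDegree_lt_iff_degree_lt hA0] at hA
      by_cases hB0 : B = 0
      · rw [hB0, degree_zero]
        exact WithBot.bot_lt_coe _
      rw [← natDegree_lt_iff_degree_lt hB0, hB, natDegree_divByMonic _ (monic_X_sub_C s),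
        natDegree_X_sub_C]
      -- For empty S the polynomial A is constant; the truncated subtraction hides that its quotient
      -- is zero, so this case must contradict `hB0`.
      have : 0 < S.card ∨ S.card = 0 := (Nat.eq_zero_or_pos _).symm
      rcases this with h | h
      · lia
      · exfalso
        refine hB0 ((divByMonic_eq_zero_iff (monic_X_sub_C s)).2 ?_)
        rw [degree_X_sub_C, ← Nat.cast_one, ← natDegree_lt_iff_degree_lt hA0]
        lia
    have hBc : ∀ i, ‖B.coeff i‖ ≤ r := by
      refine fun i => ih (fun t ht => hS1 t (Finset.mem_insert_of_mem ht))
        (fun t ht u hu => hS t (Finset.mem_insert_of_mem ht) u (Finset.mem_insert_of_mem hu))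
        B hBdeg (fun t ht => ?_) i
      have hts : ‖t - s‖ = 1 := hS t (Finset.mem_insert_of_mem ht) s (Finset.mem_insert_self s S)
        fun h => hs (h ▸ ht)
      have h1 : A.eval t - A.eval s = (t - s) * B.eval t := by
        conv_lhs => rw [hdec]
        simp
      have h2 : ‖B.eval t‖ = ‖A.eval t - A.eval s‖ := by rw [h1, norm_mul, hts, one_mul]
      rw [h2]
      exact (norm_sub_le_max _ _).trans (max_le
        (hr' t (Finset.mem_insert_of_mem ht)) (hr' s (Finset.mem_insert_self s S)))
    have hs1 := hS1 s (Finset.mem_insert_self s S)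
    have hsB : ∀ i, ‖s * B.coeff i‖ ≤ r := fun i => by
      rw [norm_mul]
      exact (mul_le_of_le_one_left (norm_nonneg _) hs1).trans (hBc i)
    rw [hdec, sub_mul]
    cases i with
    | zero =>
      simp only [coeff_add, coeff_C_zero, coeff_sub, mul_coeff_zero, coeff_X_zero, zero_mul,
        zero_sub]
      refine (IsUltrametricDist.norm_add_le_max _ _).trans
        (max_le (hr' s (Finset.mem_insert_self s S)) ?_)
      rw [norm_neg]
      exact hsB 0
    | succ i =>
      rw [coeff_add, coeff_C_succ, zero_add, coeff_sub, coeff_X_mul, coeff_C_mul]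
      exact (norm_sub_le_max _ _).trans (max_le (hBc i) (hsB _))

variable {E : Type*} [Field E] [Algebra E (PadicAlgCl p)] [Algebra ℚ_[p] E]
  [IsScalarTower ℚ_[p] E (PadicAlgCl p)]

/-- Adjoining a root of unity of order prime to `p` does not change the value group. -/
theorem HasValueGroup.adjoin_root_of_unity {ρ : ℝ} (hE : HasValueGroup p E ρ) {N : ℕ}
    (hN : ¬ p ∣ N) {z : PadicAlgCl p} (hz : z ^ N = 1) :
    HasValueGroup p (IntermediateField.adjoin E {z}) ρ := by
  rintro ⟨x, hx⟩ hx0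
  have hx0 : x ≠ 0 := fun h => hx0 (Subtype.ext h)
  change ∃ k : ℤ, ‖x‖ = ρ ^ k
  have hN0 : N ≠ 0 := fun h0 => hN (h0 ▸ dvd_zero p)
  have := isGalois_padicAlgCl p E
  have hint : IsIntegral E z := Algebra.IsIntegral.isIntegral z
  obtain ⟨A, hAdeg, rfl⟩ := exists_aeval_eq (minpoly.monic hint) (minpoly.natDegree_pos hint)
    (minpoly.aeval E z) hx
  have hA0 : A ≠ 0 := fun h => hx0 (by rw [h, map_zero])
  classical
  set S : Finset (PadicAlgCl p) := ((minpoly E z).aroots (PadicAlgCl p)).toFinset with hSdef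
  have hScard : S.card = (minpoly E z).natDegree := by
    have hnd : ((minpoly E z).aroots (PadicAlgCl p)).Nodup :=
      nodup_roots (Polynomial.Separable.map (Algebra.IsSeparable.isSeparable E z))
    rw [hSdef, Multiset.toFinset_card_of_nodup hnd, aroots,
      ← (IsAlgClosed.splits ((minpoly E z).map (algebraMap E (PadicAlgCl p)))).natDegree_eq_card_roots,
      natDegree_map]
  have hconj : ∀ s ∈ S, ∃ σ : Gal(PadicAlgCl p/E), σ z = s := by
    intro s hs
    rw [hSdef, Multiset.mem_toFinset, mem_aroots] at hs
    exact minpoly.exists_algEquiv_of_root' hint.isAlgebraic hs.2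
  have hSN : ∀ s ∈ S, s ^ N = 1 := by
    intro s hs
    obtain ⟨σ, rfl⟩ := hconj s hs
    rw [← map_pow, hz, map_one]
  have hS1 : ∀ s ∈ S, ‖s‖ = 1 := fun s hs => norm_eq_one_of_pow_eq_one hN0 (hSN s hs)
  -- At a conjugate σ z the value of A is σ(A(z)), of the same norm. The conjugates are roots of
  -- unity of order prime to p, hence at mutual distance 1, so interpolation bounds the
  -- coefficients.
  have hcoeff : ∀ i, ‖toC p (A.coeff i)‖ ≤ ‖aeval z A‖ := by
    intro i
    rw [toC, ← coeff_map]
    refine norm_coeff_le_of_eval_le (norm_nonneg _) S (fun s hs => (hS1 s hs).le) ?_ _ ?_ ?_ i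
    · intro s hs t ht hst
      refine le_antisymm ((norm_sub_le_max _ _).trans
        (max_le (hS1 s hs).le (hS1 t ht).le)) (not_lt.1 fun hlt => hst ?_)
      exact eq_of_pow_eq_pow hN (hS1 t ht) ((hSN s hs).trans (hSN t ht).symm) hlt
    · rw [degree_map, hScard]
      exact (natDegree_lt_iff_degree_lt hA0).1 hAdeg
    · intro s hs
      obtain ⟨σ, rfl⟩ := hconj s hs
      have : eval (σ z) (A.map (algebraMap E (PadicAlgCl p))) = σ (aeval z A) := by
        rw [eval_map, ← aeval_def]
        exact aeval_algHom_apply (σ : PadicAlgCl p →ₐ[E] PadicAlgCl p) z A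
      rw [this, norm_algEquiv]
  have hz1 : ‖z‖ = 1 := norm_eq_one_of_pow_eq_one hN0 hz
  obtain ⟨j, hj, hle⟩ := IsUltrametricDist.exists_norm_finsetSum_le A.support
    fun i => toC p (A.coeff i) * z ^ i
  have hsum : aeval z A = ∑ i ∈ A.support, toC p (A.coeff i) * z ^ i := by
    rw [aeval_def, eval₂_eq_sum, sum_def]
  have heq : ‖aeval z A‖ = ‖toC p (A.coeff j)‖ := by
    refine le_antisymm ?_ (hcoeff j)
    rw [hsum]
    refine hle.trans ?_
    rw [norm_mul, norm_pow, hz1, one_pow, mul_one]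
  rw [heq]
  exact hE _ (mem_support_iff.1 (hj (support_nonempty.2 hA0)))

end RootsOfUnity

/-! ### Residue fields -/

section Residue

theorem residue_eq_iff {E : Type*} [Field E] [Algebra E (PadicAlgCl p)] (x y : O p E) :
    residue (O p E) x = residue (O p E) y ↔ ‖toC p (x : E) - toC p (y : E)‖ < 1 := by
  rw [← sub_eq_zero, ← map_sub, residue_eq_zero_iff, mem_maximalIdeal_O_iff, ← toC_sub]
  rfl

variable (p) in
theorem natCard_residueField_padic : Nat.card (ResidueField (O p ℚ_[p])) = p := by
  have hn : ∀ x : ℚ_[p], ‖toC p x‖ = ‖x‖ := PadicAlgCl.norm_extends p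
  let e : ℤ_[p] ≃+* O p ℚ_[p] :=
    { toFun := fun x => ⟨x, (hn x).trans_le x.2⟩
      invFun := fun x => ⟨x, (hn x).symm.trans_le x.2⟩
      left_inv := fun _ => rfl
      right_inv := fun _ => rfl
      map_mul' := fun _ _ => rfl
      map_add' := fun _ _ => rfl }
  rw [← Nat.card_congr (ResidueField.mapEquiv e).toEquiv,
    Nat.card_congr (PadicInt.residueField (p := p)).toEquiv, Nat.card_zmod]

variable {E : Type*} [Field E] [Algebra E (PadicAlgCl p)] [Algebra ℚ_[p] E]
  [IsScalarTower ℚ_[p] E (PadicAlgCl p)]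

variable (p E) in
/-- `E` as a `ℚ_[p]`-subspace of `PadicAlgCl p`. -/
def rangeSubmodule : Submodule ℚ_[p] (PadicAlgCl p) :=
  LinearMap.range (IsScalarTower.toAlgHom ℚ_[p] E (PadicAlgCl p)).toLinearMap

theorem mem_rangeSubmodule {x : PadicAlgCl p} : x ∈ rangeSubmodule p E ↔ ∃ y : E, toC p y = x :=
  Iff.rfl

theorem finiteDimensional_rangeSubmodule [FiniteDimensional ℚ_[p] E] :
    FiniteDimensional ℚ_[p] (rangeSubmodule p E) :=
  Module.Finite.range (IsScalarTower.toAlgHom ℚ_[p] E (PadicAlgCl p)).toLinearMap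

-- The closed unit ball of E is compact, so finitely many open unit balls cover it, and each of
-- these lies in a single residue class.
variable (p E) in
theorem finite_residueField [FiniteDimensional ℚ_[p] E] : Finite (ResidueField (O p E)) := by
  have := finiteDimensional_rangeSubmodule (p := p) (E := E)
  have : ProperSpace (rangeSubmodule p E) := FiniteDimensional.proper ℚ_[p] _
  obtain ⟨t, ht, htf, hcov⟩ :=
    (isCompact_closedBall (0 : rangeSubmodule p E) 1).finite_cover_balls one_pos
  choose g hg using fun v : rangeSubmodule p E => mem_rangeSubmodule.1 v.2
  have hmem : ∀ v : t, ‖toC p (g v)‖ ≤ 1 := fun v => by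
    rw [hg]
    exact mem_closedBall_zero_iff.1 (ht v.2)
  have : Finite t := htf
  refine Finite.of_surjective (fun v : t => residue (O p E) ⟨g v, hmem v⟩) fun a => ?_
  obtain ⟨b, rfl⟩ := residue_surjective a
  have hb : (⟨toC p (b : E), b, rfl⟩ : rangeSubmodule p E) ∈ Metric.closedBall 0 1 :=
    mem_closedBall_zero_iff.2 b.2
  obtain ⟨v, hv, hbv⟩ := Set.mem_iUnion₂.1 (hcov hb)
  refine ⟨⟨v, hv⟩, (residue_eq_iff _ _).2 ?_⟩
  rw [Metric.mem_ball, dist_comm, dist_eq_norm] at hbv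
  change ‖toC p (g v) - _‖ < 1
  rw [hg]
  exact hbv

theorem natCard_residueField [Finite (ResidueField (O p E))] :
    Nat.card (ResidueField (O p E)) = p ^ residueDegree p ℚ_[p] E := by
  have : Module.Finite (ResidueField (O p ℚ_[p])) (ResidueField (O p E)) :=
    Module.Finite.of_finite
  rw [Module.natCard_eq_pow_finrank (K := ResidueField (O p ℚ_[p])), natCard_residueField_padic]
  rfl

variable (p E) in
theorem residueDegree_pos [Finite (ResidueField (O p E))] : 0 < residueDegree p ℚ_[p] E := by
  have : Module.Finite (ResidueField (O p ℚ_[p])) (ResidueField (O p E)) :=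
    Module.Finite.of_finite
  exact Module.finrank_pos

theorem not_dvd_pow_sub_one {k : ℕ} (hk : 0 < k) : ¬ p ∣ p ^ k - 1 := by
  intro h
  have h1 : p ∣ p ^ k := dvd_pow_self p hk.ne'
  have h2 : 1 ≤ p ^ k := Nat.one_le_pow _ _ (Nat.Prime.pos Fact.out)
  have := (Nat.dvd_sub_iff_right h2 h1).1 h
  exact Nat.Prime.one_lt (Fact.out : p.Prime) |>.ne' (Nat.dvd_one.1 this)

theorem norm_pow_sub_one_lt [Finite (ResidueField (O p E))] {x : E} (hx : ‖toC p x‖ = 1) :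
    ‖toC p x ^ (p ^ residueDegree p ℚ_[p] E - 1) - 1‖ < 1 := by
  have hunit : residue (O p E) ⟨x, hx.le⟩ ≠ 0 :=
    (residue_ne_zero_iff_isUnit _).2 ((isUnit_O_iff _).2 hx)
  have : Fintype (ResidueField (O p E)) := Fintype.ofFinite _
  have h := FiniteField.pow_card_sub_one_eq_one _ hunit
  rw [← Nat.card_eq_fintype_card, natCard_residueField, ← map_pow, ← map_one (residue (O p E)),
    residue_eq_iff] at h
  simpa using h

/-- The roots of unity of order dividing `p ^ f - 1` lie in `E`. -/
theorem exists_toC_eq_of_pow_eq_one [Finite (ResidueField (O p E))] {z : PadicAlgCl p}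
    (hz : z ^ (p ^ residueDegree p ℚ_[p] E - 1) = 1) : ∃ y : E, toC p y = z := by
  have hm := not_dvd_pow_sub_one (p := p) (residueDegree_pos p E)
  set m := p ^ residueDegree p ℚ_[p] E - 1 with hmdef
  have hm0 : m ≠ 0 := fun h0 => hm (h0 ▸ dvd_zero p)
  have hz1 : ‖z‖ = 1 := norm_eq_one_of_pow_eq_one hm0 hz
  have hq : p ^ residueDegree p ℚ_[p] E = m + 1 := by lia
  have : Fintype (ResidueField (O p E)) := Fintype.ofFinite _
  have hcard : Fintype.card (ResidueField (O p E)) = m + 1 := by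
    rw [← Nat.card_eq_fintype_card, natCard_residueField, hq]
  let zO : O p (PadicAlgCl p) := ⟨z, hz1.le⟩
  let f : (ResidueField (O p E))[X] := X ^ (Fintype.card (ResidueField (O p E))) - X
  have hroots : f.roots = Finset.univ.val := FiniteField.roots_X_pow_card_sub_X _
  have hdeg : f.natDegree = Fintype.card (ResidueField (O p E)) :=
    FiniteField.X_pow_card_sub_X_natDegree_eq _ Fintype.one_lt_card
  have hf0 : f ≠ 0 := FiniteField.X_pow_card_sub_X_ne_zero _ Fintype.one_lt_card
  have hs : f.Splits := splits_iff_card_roots.2 (by rw [hroots, hdeg]; rfl)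
  let i := algebraMap (ResidueField (O p E)) (ResidueField (O p (PadicAlgCl p)))
  -- The residue field of E already contains all roots of f, so the residue of z comes from some b
  -- in E. As z is the only root of unity of its order in the class of b, it is Galois-fixed.
  have hmem : residue _ zO ∈ (f.map i).roots := by
    rw [mem_roots (Polynomial.map_ne_zero hf0)]
    have hzO : zO ^ m = 1 := Subtype.ext hz
    simp only [f, IsRoot, Polynomial.map_sub, Polynomial.map_pow, map_X, eval_sub, eval_pow, eval_X,
      hcard]
    rw [pow_succ, ← map_pow, hzO, map_one, one_mul, sub_self]
  rw [hs.roots_map, hroots] at hmem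
  obtain ⟨a, -, ha⟩ := Multiset.mem_map.1 hmem
  obtain ⟨b, rfl⟩ := residue_surjective a
  have hb : ‖toC p (b : E) - z‖ < 1 := by
    have : i (residue _ b) = residue _ (algebraMap (O p E) (O p (PadicAlgCl p)) b) :=
      Valuation.HasExtension.algebraMap_residue_eq_residue_algebraMap _ _ _
    rw [this, residue_eq_iff] at ha
    exact ha
  refine mem_range_of_forall_fixed fun σ => ?_
  refine eq_of_pow_eq_pow hm hz1 (by rw [← map_pow, hz, map_one]) ?_
  refine norm_sub_lt_of_lt (y := toC p (b : E)) ?_ hb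
  have e : σ (z - toC p (b : E)) = σ z - toC p (b : E) := by rw [map_sub, AlgEquiv.commutes]
  rw [← e, norm_algEquiv, norm_sub_rev]
  exact hb

end Residue

/-! ### Completeness of rings of integers -/

section Complete

variable {E : Type*} [Field E] [Algebra E (PadicAlgCl p)] [Algebra ℚ_[p] E]
  [IsScalarTower ℚ_[p] E (PadicAlgCl p)]

theorem IsGenerator.mem_pow_iff {x : O p E} (hx : IsGenerator p x) (n : ℕ) (y : O p E) :
    y ∈ maximalIdeal (O p E) ^ n ↔ ‖toC p (y : E)‖ ≤ ‖toC p (x : E)‖ ^ n := by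
  have hx0 : (x : E) ^ n ≠ 0 := pow_ne_zero _ fun h => by
    have := hx.norm_pos
    rw [h, toC_zero, norm_zero] at this
    exact lt_irrefl _ this
  rw [hx, Ideal.span_singleton_pow, Ideal.mem_span_singleton', ← norm_pow, ← toC_pow]
  constructor
  · rintro ⟨a, rfl⟩
    rw [MulMemClass.coe_mul, toC_mul, norm_mul]
    exact mul_le_of_le_one_left (norm_nonneg _) a.2
  · intro h
    refine ⟨⟨(y : E) / (x : E) ^ n, ?_⟩, Subtype.ext (div_mul_cancel₀ _ hx0)⟩
    rw [mem_O_iff, toC_div, norm_div]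
    exact div_le_one_of_le₀ h (norm_nonneg _)

theorem isComplete_rangeSubmodule [FiniteDimensional ℚ_[p] E] :
    IsComplete (rangeSubmodule p E : Set (PadicAlgCl p)) := by
  have := finiteDimensional_rangeSubmodule (p := p) (E := E)
  exact Submodule.complete_of_finiteDimensional _

/-- Powers of the maximal ideal are norm balls, and E is complete as a finite-dimensional space over
`ℚ_[p]`. Weierstrass preparation requires this. -/
theorem IsGenerator.isAdicComplete [FiniteDimensional ℚ_[p] E] {x : O p E}
    (hx : IsGenerator p x) : IsAdicComplete (maximalIdeal (O p E)) (O p E) := by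
  have hx1 := ((isGenerator_iff x).1 hx).1
  have hlim := tendsto_pow_atTop_nhds_zero_of_lt_one hx.norm_pos.le hx1
  have key : ∀ (n : ℕ) (a b : O p E),
      a ≡ b [SMOD (maximalIdeal (O p E) ^ n • ⊤ : Submodule (O p E) (O p E))] ↔
        ‖toC p (a : E) - toC p (b : E)‖ ≤ ‖toC p (x : E)‖ ^ n := by
    intro n a b
    rw [SModEq.sub_mem, smul_eq_mul, Ideal.mul_top, hx.mem_pow_iff, ← toC_sub]
    rfl
  refine { haus' := fun y hy => ?_, prec' := fun f hf => ?_ }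
  · have h : ∀ n : ℕ, ‖toC p (y : E)‖ ≤ ‖toC p (x : E)‖ ^ n := fun n => by
      have := (key n y 0).1 (hy n)
      rwa [ZeroMemClass.coe_zero, toC_zero, sub_zero] at this
    have h0 : ‖toC p (y : E)‖ ≤ 0 := ge_of_tendsto' hlim h
    exact Subtype.ext (toC_injective ((norm_le_zero_iff.1 h0).trans toC_zero.symm))
  · have hd : ∀ m n, m ≤ n →
        ‖toC p (f m : E) - toC p (f n : E)‖ ≤ ‖toC p (x : E)‖ ^ m :=
      fun m n hmn => (key m _ _).1 (hf hmn)
    have hc : CauchySeq fun n => toC p (f n : E) := by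
      refine cauchySeq_of_le_tendsto_0 (fun n => ‖toC p (x : E)‖ ^ n) (fun n m N hn hm => ?_) hlim
      rw [dist_eq_norm, ← sub_add_sub_cancel _ (toC p (f N : E))]
      refine (IsUltrametricDist.norm_add_le_max _ _).trans (max_le ?_ (hd N m hm))
      rw [norm_sub_rev]
      exact hd N n hn
    obtain ⟨y, hy, hty⟩ := cauchySeq_tendsto_of_isComplete isComplete_rangeSubmodule
      (fun n => mem_rangeSubmodule.2 ⟨(f n : E), rfl⟩) hc
    obtain ⟨l, rfl⟩ := mem_rangeSubmodule.1 hy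
    have hl : ‖toC p l‖ ≤ 1 := le_of_tendsto' hty.norm fun n => (f n).2
    refine ⟨⟨l, hl⟩, fun n => (key n _ _).2 ?_⟩
    refine le_of_tendsto ((tendsto_const_nhds.sub hty).norm) ?_
    filter_upwards [Filter.eventually_ge_atTop n] with m hm using hd n m hm

end Complete

/-! ### Evaluating power series with integral coefficients -/

section Evaluation

variable {K : IntermediateField ℚ_[p] (PadicAlgCl p)}

/-- `PadicAlgCl p` is not complete, so the series is summed in the finite extension K(z) of `ℚ_[p]`,
which contains all its terms. -/
theorem exists_hasSum [FiniteDimensional ℚ_[p] K] (G : PowerSeries (O p K)) {z : PadicAlgCl p}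
    (hz : ‖z‖ < 1) :
    ∃ s, HasSum (fun n : ℕ => toC p ((PowerSeries.coeff n G : O p K) : K) * z ^ n) s := by
  have hint : IsIntegral ℚ_[p] z := Algebra.IsIntegral.isIntegral z
  have := IntermediateField.adjoin.finiteDimensional hint
  let L : IntermediateField ℚ_[p] (PadicAlgCl p) := K ⊔ IntermediateField.adjoin ℚ_[p] {z}
  have : FiniteDimensional ℚ_[p] L := IntermediateField.finiteDimensional_sup _ _
  let V : Submodule ℚ_[p] (PadicAlgCl p) := Subalgebra.toSubmodule L.toSubalgebra
  have : FiniteDimensional ℚ_[p] V := this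
  have : CompleteSpace V := FiniteDimensional.complete ℚ_[p] V
  have hmem : ∀ n : ℕ, toC p ((PowerSeries.coeff n G : O p K) : K) * z ^ n ∈ L := fun n =>
    mul_mem ((le_sup_left : K ≤ L) (PowerSeries.coeff n G : O p K).1.2)
      (pow_mem ((le_sup_right : _ ≤ L) (IntermediateField.mem_adjoin_simple_self _ z)) n)
  have hs : Summable fun n : ℕ => (⟨_, hmem n⟩ : V) := by
    refine Summable.of_norm_bounded (summable_geometric_of_lt_one (norm_nonneg z) hz) fun n => ?_
    change ‖toC p ((PowerSeries.coeff n G : O p K) : K) * z ^ n‖ ≤ _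
    rw [norm_mul, norm_pow]
    exact mul_le_of_le_one_left (pow_nonneg (norm_nonneg _) _) (PowerSeries.coeff n G : O p K).2
  obtain ⟨s, hs⟩ := hs
  exact ⟨_, hs.mapL V.subtypeL⟩

theorem hasSum_coe_mul {u : PowerSeries (O p K)} {z s : PadicAlgCl p}
    (hs : HasSum (fun n : ℕ => toC p ((PowerSeries.coeff n u : O p K) : K) * z ^ n) s)
    (f : (O p K)[X]) :
    HasSum (fun n : ℕ => toC p ((PowerSeries.coeff n (f * u) : O p K) : K) * z ^ n)
      (aeval z (f.map (algebraMap (O p K) K)) * s) := by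
  induction f using Polynomial.induction_on with
  | C a =>
    have e1 : ∀ n : ℕ, toC p ((PowerSeries.coeff n (((C a : (O p K)[X]) : PowerSeries (O p K)) * u) :
        O p K) : K) * z ^ n = toC p (a : K) * (toC p ((PowerSeries.coeff n u : O p K) : K) * z ^ n) :=
      fun n => by rw [coe_C, PowerSeries.coeff_C_mul, MulMemClass.coe_mul, toC_mul, mul_assoc]
    rw [map_C, aeval_C]
    simp only [e1]
    exact hs.mul_left (toC p (a : K))
  | add f g hf hg =>
    have e1 : ∀ n : ℕ, toC p ((PowerSeries.coeff n (((f + g : (O p K)[X]) : PowerSeries (O p K)) * u) :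
        O p K) : K) * z ^ n = toC p ((PowerSeries.coeff n (f * u) : O p K) : K) * z ^ n +
          toC p ((PowerSeries.coeff n (g * u) : O p K) : K) * z ^ n :=
      fun n => by rw [coe_add, add_mul, map_add, AddMemClass.coe_add, toC, map_add, add_mul]
    rw [Polynomial.map_add, map_add, add_mul]
    simp only [e1]
    exact hf.add hg
  | monomial n a ih =>
    have e : (C a * X ^ (n + 1) : (O p K)[X]) = (C a * X ^ n) * X := by rw [pow_succ, mul_assoc]
    rw [e]
    set f : (O p K)[X] := C a * X ^ n
    rw [← hasSum_nat_add_iff' 1]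
    have h0 : PowerSeries.coeff 0 (((f * X : (O p K)[X]) : PowerSeries (O p K)) * u) = 0 := by
      rw [mul_comm f X, coe_mul, coe_X, mul_assoc, PowerSeries.coeff_zero_X_mul]
    rw [Finset.sum_range_one, h0, ZeroMemClass.coe_zero, toC_zero, zero_mul, sub_zero]
    have e1 : ∀ m : ℕ, toC p ((PowerSeries.coeff (m + 1) (((f * X : (O p K)[X]) :
        PowerSeries (O p K)) * u) : O p K) : K) * z ^ (m + 1) =
          z * (toC p ((PowerSeries.coeff m (f * u) : O p K) : K) * z ^ m) := fun m => by
      rw [mul_comm f X, coe_mul, coe_X, mul_assoc, PowerSeries.coeff_succ_X_mul]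
      ring
    simp only [e1]
    rw [Polynomial.map_mul, map_X, map_mul, aeval_X, mul_comm _ z, mul_assoc]
    exact ih.mul_left z

/-- The constant term is a unit and the other terms have norm at most ‖z‖ < 1. So the unit factor in
Weierstrass preparation contributes no zeros. -/
theorem norm_eq_one_of_hasSum {u : PowerSeries (O p K)} (hu : IsUnit u) {z s : PadicAlgCl p}
    (hz : ‖z‖ < 1)
    (hs : HasSum (fun n : ℕ => toC p ((PowerSeries.coeff n u : O p K) : K) * z ^ n) s) :
    ‖s‖ = 1 := by
  have hu0 : ‖toC p ((PowerSeries.coeff 0 u : O p K) : K)‖ = 1 := by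
    rw [← isUnit_O_iff, PowerSeries.coeff_zero_eq_constantCoeff_apply]
    exact PowerSeries.isUnit_iff_constantCoeff.1 hu
  refine norm_eq_one_of_norm_sub_lt hu0 (lt_of_le_of_lt ?_ hz)
  have h1 := (hasSum_nat_add_iff' 1).2 hs
  rw [Finset.sum_range_one, pow_zero, mul_one] at h1
  rw [← h1.tsum_eq]
  refine IsUltrametricDist.norm_tsum_le_of_forall_le_of_nonneg (norm_nonneg z) fun n => ?_
  rw [norm_mul, norm_pow]
  refine (mul_le_of_le_one_left (pow_nonneg (norm_nonneg _) _)
    (PowerSeries.coeff (n + 1) u : O p K).2).trans ?_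
  exact pow_le_of_le_one (norm_nonneg _) hz.le n.succ_ne_zero

end Evaluation

/-! ### The zeros of `[π](X)` -/

section Zeros

/-- If ‖z‖ ≥ 1 the leading term would dominate. So ‖z‖ < 1, the middle terms have norm at most ρ‖z‖
< ρ, and z^n must balance the constant term. -/
theorem norm_pow_eq_of_eisenstein {F : Type*} [Field F] [Algebra F (PadicAlgCl p)] {g : F[X]}
    {n : ℕ} (hg : g.Monic) (hn : g.natDegree = n) (hn0 : 0 < n) {ρ : ℝ} (h0 : 0 < ρ) (h1 : ρ < 1)
    (hc : ∀ i < n, ‖toC p (g.coeff i)‖ ≤ ρ) (hc0 : ‖toC p (g.coeff 0)‖ = ρ)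
    {z : PadicAlgCl p} (hz : aeval z g = 0) : ‖z‖ ^ n = ρ := by
  have hlead : toC p (g.coeff n) = 1 := by rw [← hn, hg.coeff_natDegree, toC, map_one]
  rw [aeval_eq_sum_range, hn] at hz
  simp only [Algebra.smul_def] at hz
  change ∑ i ∈ Finset.range (n + 1), toC p (g.coeff i) * z ^ i = 0 at hz
  have hz1 : ‖z‖ < 1 := by
    by_contra! hge
    rw [Finset.sum_range_succ, hlead, one_mul] at hz
    obtain ⟨i, hi, hle⟩ := IsUltrametricDist.exists_norm_finsetSum_le (Finset.range n)
      (fun i => toC p (g.coeff i) * z ^ i)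
    have hin := Finset.mem_range.1 (hi (Finset.nonempty_range_iff.2 hn0.ne'))
    rw [eq_neg_of_add_eq_zero_left hz, norm_neg, norm_pow, norm_mul, norm_pow] at hle
    have h2 : ‖z‖ ^ i ≤ ‖z‖ ^ n := pow_le_pow_right₀ hge hin.le
    have h3 : 0 < ‖z‖ ^ i := pow_pos (one_pos.trans_le hge) i
    have h4 := (hc i hin).trans_lt h1
    exact absurd (hle.trans_lt (mul_lt_of_lt_one_left h3 h4)) (not_lt.2 h2)
  obtain ⟨k, rfl⟩ := Nat.exists_eq_add_of_le' hn0
  rw [Finset.sum_range_succ, hlead, one_mul, Finset.sum_range_succ', pow_zero, mul_one] at hz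
  have hR : ‖∑ i ∈ Finset.range k, toC p (g.coeff (i + 1)) * z ^ (i + 1)‖ ≤ ρ * ‖z‖ := by
    refine IsUltrametricDist.norm_sum_le_of_forall_le_of_nonneg
      (mul_nonneg h0.le (norm_nonneg _)) fun i hi => ?_
    rw [norm_mul, norm_pow]
    exact mul_le_mul (hc _ (by have := Finset.mem_range.1 hi; lia))
      (pow_le_of_le_one (norm_nonneg _) hz1.le i.succ_ne_zero) (pow_nonneg (norm_nonneg _) _) h0.le
  have hlt := hR.trans_lt (mul_lt_of_lt_one_right h0 hz1)
  have e : z ^ (k + 1) = -(toC p (g.coeff 0) +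
      ∑ i ∈ Finset.range k, toC p (g.coeff (i + 1)) * z ^ (i + 1)) := by
    rw [eq_neg_iff_add_eq_zero, ← hz]
    ring
  rw [← norm_pow, e, norm_neg, IsUltrametricDist.norm_add_eq_max_of_norm_ne_norm
    (by rw [hc0]; exact hlt.ne'), hc0, max_eq_left hlt.le]

variable {K : IntermediateField ℚ_[p] (PadicAlgCl p)}

/-- The zeros of a power series `π X + ⋯` of Weierstrass degree `n + 1` in the open unit disc are
`0` and the roots of an Eisenstein polynomial of degree `n`. -/
theorem exists_eisenstein [FiniteDimensional ℚ_[p] K] {π : O p K} (hπ : IsGenerator p π)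
    {G : PowerSeries (O p K)} (hG0 : PowerSeries.coeff 0 G = 0) (hG1 : PowerSeries.coeff 1 G = π)
    {n : ℕ} (hn : 0 < n) (hGn : ‖toC p ((PowerSeries.coeff (n + 1) G : O p K) : K)‖ = 1)
    (hGi : ∀ i, 2 ≤ i → i < n + 1 → ‖toC p ((PowerSeries.coeff i G : O p K) : K)‖ < 1) :
    ∃ g : K[X], g.Monic ∧ g.natDegree = n ∧
      (∀ z : PadicAlgCl p, aeval z g = 0 → ‖z‖ ^ n = ‖toC p (π : K)‖) ∧
      {z : PadicAlgCl p | ‖z‖ < 1 ∧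
        HasSum (fun n : ℕ => toC p ((PowerSeries.coeff n G : O p K) : K) * z ^ n) 0} =
        {z | z = 0 ∨ aeval z g = 0} := by
  have hπ1 := ((isGenerator_iff π).1 hπ).1
  have := hπ.isAdicComplete
  have hord : (G.map (residue (O p K))).order = (n + 1 : ℕ) := by
    refine PowerSeries.order_eq_nat.2 ⟨?_, fun i hi => ?_⟩
    · rw [PowerSeries.coeff_map, residue_ne_zero_iff_isUnit, isUnit_O_iff]
      exact hGn
    · rw [PowerSeries.coeff_map, residue_eq_zero_iff, mem_maximalIdeal_O_iff]
      match i with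
      | 0 => simp [hG0]
      | 1 => rwa [hG1]
      | i + 2 => exact hGi _ (by lia) hi
  have hne : G.map (residue (O p K)) ≠ 0 := fun h => by
    rw [h, PowerSeries.order_zero] at hord
    exact ENat.top_ne_natCast _ hord
  obtain ⟨f, u, hfu⟩ := PowerSeries.exists_isWeierstrassFactorization hne
  have hdeg : f.natDegree = n + 1 := by
    have h := hfu.natDegree_eq_toNat_order_map
    rwa [hord, ENat.toNat_natCast] at h
  have hu0 : IsUnit (PowerSeries.constantCoeff u) :=
    PowerSeries.isUnit_iff_constantCoeff.1 hfu.isUnit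
  have hf0 : f.coeff 0 = 0 := by
    have h := hG0
    rw [hfu.eq_mul, PowerSeries.coeff_zero_eq_constantCoeff_apply, map_mul,
      ← PowerSeries.coeff_zero_eq_constantCoeff_apply, coeff_coe] at h
    exact hu0.mul_left_eq_zero.1 h
  -- Since f has no constant term, the linear coefficient of f u is f₁u₀ = π with u₀ a unit. Hence
  -- f/X is Eisenstein.
  have hf1 : ‖toC p (f.coeff 1 : K)‖ = ‖toC p (π : K)‖ := by
    have h := hG1
    rw [hfu.eq_mul, PowerSeries.coeff_one_mul,
      ← PowerSeries.coeff_zero_eq_constantCoeff_apply (f : PowerSeries (O p K)), coeff_coe,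
      coeff_coe, hf0, mul_zero, add_zero] at h
    rw [← h, MulMemClass.coe_mul, toC_mul, norm_mul, (isUnit_O_iff _).1 hu0, mul_one]
  have hfX : f = X * f.divX := by
    have := X_mul_divX_add f
    rwa [hf0, C_0, add_zero, eq_comm] at this
  have hmon : f.divX.Monic := by
    have h := hfu.isDistinguishedAt.monic
    rw [hfX] at h
    exact monic_X.of_mul_monic_left h
  have hgmon : (f.divX.map (algebraMap (O p K) K)).Monic := hmon.map _
  have hgdeg : (f.divX.map (algebraMap (O p K) K)).natDegree = n := by
    rw [hmon.natDegree_map, natDegree_divX_eq_natDegree_tsub_one, hdeg, Nat.add_sub_cancel]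
  have hroot : ∀ z : PadicAlgCl p, aeval z (f.divX.map (algebraMap (O p K) K)) = 0 →
      ‖z‖ ^ n = ‖toC p (π : K)‖ := by
    intro z hz
    refine norm_pow_eq_of_eisenstein hgmon hgdeg hn hπ.norm_pos hπ1 (fun i hi => ?_) ?_ hz
    · rw [coeff_map, coeff_divX]
      refine ((isGenerator_iff π).1 hπ).2 _ ((mem_maximalIdeal_O_iff _).1 ?_)
      exact hfu.isDistinguishedAt.mem (by lia)
    · rw [coeff_map, coeff_divX]
      exact hf1
  have hev : ∀ z : PadicAlgCl p, aeval z (f.map (algebraMap (O p K) K)) =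
      z * aeval z (f.divX.map (algebraMap (O p K) K)) := fun z => by
    conv_lhs => rw [hfX]
    rw [Polynomial.map_mul, map_X, map_mul, aeval_X]
  refine ⟨_, hgmon, hgdeg, hroot, Set.ext fun z => ?_⟩
  have hz1 : (z = 0 ∨ aeval z (f.divX.map (algebraMap (O p K) K)) = 0) → ‖z‖ < 1 := by
    rintro (rfl | hz)
    · simp
    · by_contra! hge
      exact absurd hπ1 (not_lt.2 (hroot z hz ▸ one_le_pow₀ hge))
  simp only [Set.mem_ofPred_eq]
  rw [← mul_eq_zero, ← hev] at hz1 ⊢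
  constructor
  · rintro ⟨hz, hsum⟩
    obtain ⟨s, hs⟩ := exists_hasSum u hz
    have h := hasSum_coe_mul hs f
    rw [← hfu.eq_mul] at h
    refine (mul_eq_zero.1 (h.unique hsum)).resolve_right fun hs0 => ?_
    have := norm_eq_one_of_hasSum hfu.isUnit hz hs
    rw [hs0, norm_zero] at this
    exact zero_ne_one this
  · intro hz
    refine ⟨hz1 hz, ?_⟩
    obtain ⟨s, hs⟩ := exists_hasSum u (hz1 hz)
    have h := hasSum_coe_mul hs f
    rwa [← hfu.eq_mul, hz, zero_mul] at h

end Zeros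

/-! ### Totally and tamely ramified extensions -/

section Tame

/-! ### Residue classes, uniformizer and degree of F(P) -/

section Approximation

variable {F : Type*} [Field F] [Algebra F (PadicAlgCl p)] {ρ : ℝ} {P : PadicAlgCl p} {n : ℕ}
  {g : F[X]}

theorem norm_lt_one_of_pow_eq (h1 : ρ < 1) (hP : ‖P‖ ^ n = ρ) : ‖P‖ < 1 := by
  by_contra! h
  exact absurd h1 (not_lt.2 (hP ▸ one_le_pow₀ h))

theorem norm_pos_of_pow_eq (h0 : 0 < ρ) (hn : 0 < n) (hP : ‖P‖ ^ n = ρ) : 0 < ‖P‖ := by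
  refine (norm_nonneg P).lt_of_ne fun h => ?_
  rw [← h, zero_pow hn.ne'] at hP
  exact h0.ne hP

/-- A totally ramified extension has the same residue field. -/
theorem exists_norm_sub_le (hF : HasValueGroup p F ρ) (h0 : 0 < ρ) (h1 : ρ < 1)
    (hP : ‖P‖ ^ n = ρ) (hg : g.Monic) (hgn : g.natDegree = n) (hn : 0 < n) (hgP : aeval P g = 0)
    {x : PadicAlgCl p} (hx : x ∈ IntermediateField.adjoin F {P}) (hx1 : ‖x‖ ≤ 1) :
    ∃ c : F, ‖x - toC p c‖ ≤ ‖P‖ := by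
  have hP1 := norm_lt_one_of_pow_eq h1 hP
  have hP0 := norm_pos_of_pow_eq h0 hn hP
  obtain ⟨A, hA, rfl⟩ := exists_aeval_eq hg (hgn ▸ hn) hgP hx
  rw [hgn] at hA
  refine ⟨A.coeff 0, ?_⟩
  have hsum : aeval P A - toC p (A.coeff 0) =
      ∑ i ∈ Finset.range A.natDegree, toC p (A.coeff (i + 1)) * P ^ (i + 1) := by
    rw [aeval_eq_sum_range, Finset.sum_range_succ']
    simp only [Algebra.smul_def, pow_zero, mul_one]
    exact add_sub_cancel_right _ _
  rw [hsum]
  refine IsUltrametricDist.norm_sum_le_of_forall_le_of_nonneg hP0.le fun i hi => ?_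
  have hin : i + 1 < n := by
    have := Finset.mem_range.1 hi
    lia
  have hle := (norm_coeff_mul_le_norm_aeval hF h0 h1 hP hA (i + 1)).trans hx1
  -- A coefficient of norm above 1 has norm at least ρ⁻¹, while ‖P‖^(i+1) > ρ because i + 1 < n; the
  -- term would exceed 1, against orthogonality.
  have ha : ‖toC p (A.coeff (i + 1))‖ ≤ 1 := by
    by_cases h : A.coeff (i + 1) = 0
    · rw [h, toC_zero, norm_zero]
      exact zero_le_one
    obtain ⟨k, hk⟩ := hF _ h
    rw [hk]
    refine zpow_le_one₀ h0 h1.le ?_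
    by_contra! hneg
    have h2 : ρ⁻¹ ≤ ρ ^ k := by
      rw [← zpow_neg_one]
      exact zpow_le_zpow_right_of_le_one₀ h0 h1.le (by lia)
    have h3 : ρ < ‖P‖ ^ (i + 1) := by
      rw [← hP]
      exact pow_lt_pow_right_of_lt_one₀ hP0 hP1 hin
    have h4 : 1 < ρ⁻¹ * ‖P‖ ^ (i + 1) := by
      rw [← inv_mul_cancel₀ h0.ne']
      exact mul_lt_mul_of_pos_left h3 (inv_pos.2 h0)
    rw [hk] at hle
    exact absurd (h4.trans_le (mul_le_mul_of_nonneg_right h2 (pow_nonneg hP0.le _)))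
      (not_lt.2 hle)
  rw [norm_mul, norm_pow]
  exact (mul_le_of_le_one_left (pow_nonneg hP0.le _) ha).trans
    (pow_le_of_le_one hP0.le hP1.le i.succ_ne_zero)

/-- This makes P a uniformizer of F(P): x is within ‖P‖ of some c in F with ‖c‖ < 1, and then ‖c‖ ≤
ρ ≤ ‖P‖. -/
theorem norm_le_of_mem_adjoin (hF : HasValueGroup p F ρ) (h0 : 0 < ρ) (h1 : ρ < 1)
    (hP : ‖P‖ ^ n = ρ) (hg : g.Monic) (hgn : g.natDegree = n) (hn : 0 < n) (hgP : aeval P g = 0)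
    {x : PadicAlgCl p} (hx : x ∈ IntermediateField.adjoin F {P}) (hx1 : ‖x‖ < 1) :
    ‖x‖ ≤ ‖P‖ := by
  have hP1 := norm_lt_one_of_pow_eq h1 hP
  obtain ⟨c, hc⟩ := exists_norm_sub_le hF h0 h1 hP hg hgn hn hgP hx hx1.le
  have hc1 : ‖toC p c‖ < 1 := by
    have h := norm_sub_le_max x (x - toC p c)
    rw [sub_sub_cancel] at h
    exact h.trans_lt (max_lt hx1 (hc.trans_lt hP1))
  have hcP : ‖toC p c‖ ≤ ‖P‖ := by
    refine (hF.norm_le h0 h1 hc1).trans ?_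
    rw [← hP]
    exact pow_le_of_le_one (norm_nonneg _) hP1.le hn.ne'
  have h := IsUltrametricDist.norm_add_le_max (x - toC p c) (toC p c)
  rw [sub_add_cancel] at h
  exact h.trans (max_le hc hcP)

/-- By orthogonality of the powers of P, no nonzero polynomial of degree below n vanishes at P. -/
theorem natDegree_minpoly_eq (hF : HasValueGroup p F ρ) (h0 : 0 < ρ) (h1 : ρ < 1)
    (hP : ‖P‖ ^ n = ρ) (hg : g.Monic) (hgn : g.natDegree = n) (hn : 0 < n)
    (hgP : aeval P g = 0) : (minpoly F P).natDegree = n := by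
  have hint : IsIntegral F P := ⟨g, hg, by rwa [← aeval_def]⟩
  refine le_antisymm (hgn ▸ natDegree_le_natDegree (minpoly.min F P hg hgP)) ?_
  by_contra! hlt
  have h := norm_coeff_mul_le_norm_aeval hF h0 h1 hP hlt (minpoly F P).natDegree
  rw [(minpoly.monic hint).coeff_natDegree, minpoly.aeval, norm_zero, toC, map_one, norm_one,
    one_mul] at h
  exact absurd h (not_le.2 (pow_pos (norm_pos_of_pow_eq h0 hn hP) _))

theorem finrank_adjoin_eq (hF : HasValueGroup p F ρ) (h0 : 0 < ρ) (h1 : ρ < 1)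
    (hP : ‖P‖ ^ n = ρ) (hg : g.Monic) (hgn : g.natDegree = n) (hn : 0 < n)
    (hgP : aeval P g = 0) : Module.finrank F (IntermediateField.adjoin F {P}) = n := by
  have hint : IsIntegral F P := ⟨g, hg, by rwa [← aeval_def]⟩
  rw [IntermediateField.adjoin.finrank hint, natDegree_minpoly_eq hF h0 h1 hP hg hgn hn hgP]

end Approximation

variable {K : IntermediateField ℚ_[p] (PadicAlgCl p)} {n : ℕ}

/-- A totally and tamely ramified extension is generated by a radical. -/
theorem exists_radical_generator {π : O p K} (hπ : IsGenerator p π) (hn : 0 < n) (hpn : ¬ p ∣ n)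
    {g : K[X]} (hg : g.Monic) (hgn : g.natDegree = n) {z : PadicAlgCl p} (hgz : aeval z g = 0)
    (hz : ‖z‖ ^ n = ‖toC p (π : K)‖) :
    ∃ (P : PadicAlgCl p) (π' : O p K), IsGenerator p π' ∧ P ^ n = toC p (π' : K) ∧
      ‖P‖ ^ n = ‖toC p (π : K)‖ ∧
      IntermediateField.adjoin K {P} = IntermediateField.adjoin K {z} := by
  have h0 := hπ.norm_pos
  have h1 := ((isGenerator_iff π).1 hπ).1
  have hz1 := norm_lt_one_of_pow_eq h1 hz
  have hπ0 : toC p (π : K) ≠ 0 := norm_pos_iff.1 h0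
  set L := IntermediateField.adjoin K {z} with hL
  have hzL : z ∈ L := IntermediateField.mem_adjoin_simple_self K z
  have huL : z ^ n / toC p (π : K) ∈ L := div_mem (pow_mem hzL n) (L.algebraMap_mem _)
  have hu1 : ‖z ^ n / toC p (π : K)‖ = 1 := by
    rw [norm_div, norm_pow, hz, div_self h0.ne']
  obtain ⟨c, hc⟩ := exists_norm_sub_le hπ.hasValueGroup h0 h1 hz hg hgn hn hgz huL hu1.le
  have hc1 : ‖toC p c‖ = 1 :=
    norm_eq_one_of_norm_sub_lt hu1 (by rw [norm_sub_rev]; exact hc.trans_lt hz1)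
  have hc0 : toC p c ≠ 0 := norm_ne_zero_iff.1 (hc1 ▸ one_ne_zero)
  let b : L := ⟨z ^ n / toC p (π : K) / toC p c, div_mem huL (L.algebraMap_mem _)⟩
  have hb : toC p b = z ^ n / toC p (π : K) / toC p c := rfl
  have h1L : toC p (1 : L) = 1 := map_one _
  -- The unit z^n/(πc) is congruent to 1, hence equals w^n with w in K(z). The radical is z/w, with
  -- n-th power πc.
  obtain ⟨w, hwb, hw1⟩ := exists_pow_eq_of_norm_sub_lt (E := L) hpn 1 b (by rw [h1L, norm_one]) (by
    rw [h1L, one_pow, hb, norm_sub_rev, div_sub_one hc0, norm_div, hc1, div_one]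
    exact hc.trans_lt hz1)
  rw [h1L] at hw1
  have hwn : ‖toC p w‖ = 1 := norm_eq_one_of_norm_sub_lt norm_one hw1
  have hw0 : toC p w ≠ 0 := norm_ne_zero_iff.1 (hwn ▸ one_ne_zero)
  have hwpow : toC p w ^ n = z ^ n / toC p (π : K) / toC p c := by rw [← toC_pow, hwb, hb]
  have hz0 : z ≠ 0 := norm_pos_iff.1 (norm_pos_of_pow_eq h0 hn hz)
  have hPn : (z / toC p w) ^ n = toC p ((π : K) * c) := by
    rw [div_pow, hwpow, toC_mul]
    field_simp
  have hP : ‖z / toC p w‖ ^ n = ‖toC p (π : K)‖ := by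
    rw [norm_div, hwn, div_one, hz]
  refine ⟨z / toC p w, π * ⟨c, hc1.le⟩, ?_, hPn, hP, ?_⟩
  · rw [isGenerator_iff, MulMemClass.coe_mul, toC_mul, norm_mul, hc1, mul_one]
    exact (isGenerator_iff π).1 hπ
  · have hint : IsIntegral K z := Algebra.IsIntegral.isIntegral z
    have := IntermediateField.adjoin.finiteDimensional hint
    refine IntermediateField.eq_of_le_of_finrank_eq ?_ ?_
    · rw [IntermediateField.adjoin_simple_le_iff]
      exact div_mem hzL w.2
    · rw [finrank_adjoin_eq hπ.hasValueGroup h0 h1 hz hg hgn hn hgz]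
      refine finrank_adjoin_eq hπ.hasValueGroup h0 h1 hP (monic_X_pow_sub_C ((π : K) * c) hn.ne')
        (natDegree_X_pow_sub_C) hn ?_
      rw [map_sub, map_pow, aeval_X, aeval_C, hPn, sub_self]

theorem aeval_X_pow_sub_C_eq_zero {F : Type*} [Field F] [Algebra F (PadicAlgCl p)] {a : F}
    {P : PadicAlgCl p} (hP : P ^ n = toC p a) : aeval P (X ^ n - C a : F[X]) = 0 := by
  rw [map_sub, map_pow, aeval_X, aeval_C, hP, sub_self]

/-- The polynomial g is the minimal polynomial of z, so z' is conjugate to z; and K(P) is stable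
under conjugation because σ P/P is an n-th root of unity, hence in K. -/
theorem mem_adjoin_of_aeval_eq_zero {π : O p K} (hπ : IsGenerator p π) (hn : 0 < n)
    (hμ : ∀ x : PadicAlgCl p, x ^ n = 1 → ∃ y : K, toC p y = x)
    {g : K[X]} (hg : g.Monic) (hgn : g.natDegree = n) {z z' : PadicAlgCl p} (hgz : aeval z g = 0)
    (hz : ‖z‖ ^ n = ‖toC p (π : K)‖) (hgz' : aeval z' g = 0) {P : PadicAlgCl p} {a : K}
    (hPa : P ^ n = toC p a) (hzP : z ∈ IntermediateField.adjoin K {P}) :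
    z' ∈ IntermediateField.adjoin K {P} := by
  have h0 := hπ.norm_pos
  have h1 := ((isGenerator_iff π).1 hπ).1
  have := isGalois_padicAlgCl p K
  have hint : IsIntegral K z := Algebra.IsIntegral.isIntegral z
  have hmin : minpoly K z = g := by
    refine (eq_of_monic_of_dvd_of_natDegree_le (minpoly.monic hint) hg (minpoly.dvd K z hgz) ?_).symm
    rw [hgn, natDegree_minpoly_eq hπ.hasValueGroup h0 h1 hz hg hgn hn hgz]
  obtain ⟨σ, rfl⟩ := minpoly.exists_algEquiv_of_root' hint.isAlgebraic (hmin ▸ hgz')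
  have hσP : σ P ∈ IntermediateField.adjoin K {P} := by
    by_cases hP0 : P = 0
    · rw [hP0, map_zero]
      exact zero_mem _
    obtain ⟨y, hy⟩ := hμ (σ P / P) (by
      rw [div_pow, ← map_pow, hPa, AlgEquiv.commutes]
      have hPn := pow_ne_zero n hP0
      rw [hPa] at hPn
      exact div_self hPn)
    rw [← div_mul_cancel₀ (σ P) hP0, ← hy]
    exact mul_mem (IntermediateField.algebraMap_mem _ y)
      (IntermediateField.mem_adjoin_simple_self K P)
  have hmap : σ z ∈ (IntermediateField.adjoin K {P}).map (σ : PadicAlgCl p →ₐ[K] PadicAlgCl p) :=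
    ⟨z, hzP, rfl⟩
  rw [IntermediateField.adjoin_map, Set.image_singleton] at hmap
  exact (IntermediateField.adjoin_simple_le_iff.2 hσP) hmap

end Tame

/-! ### Existence of admissible pairs -/

section Existence

variable {K : IntermediateField ℚ_[p] (PadicAlgCl p)} [FiniteDimensional ℚ_[p] K]

/-- If h ∣ f then p^h - 1 divides p^f - 1. This is the only role of the hypothesis h ∣ f. -/
theorem exists_toC_eq_of_dvd {h : ℕ} (hdvd : h ∣ residueDegree p ℚ_[p] K) (x : PadicAlgCl p)
    (hx : x ^ (p ^ h - 1) = 1) : ∃ y : K, toC p y = x := by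
  have := finite_residueField p K
  obtain ⟨k, hk⟩ := Nat.pow_sub_one_dvd_pow_sub_one p hdvd
  exact exists_toC_eq_of_pow_eq_one (by rw [hk, pow_mul, hx, one_pow])

theorem UnramifiedGroupLaw.HasHeight.exists_isAdmissiblePair {π : O p K} (hπ : IsGenerator p π)
    {F : UnramifiedGroupLaw p K π} {h : ℕ} (hF : F.HasHeight h)
    (hdvd : h ∣ residueDegree p ℚ_[p] K) : ∃ P π', F.IsAdmissiblePair (p ^ h) P π' := by
  obtain ⟨hh, ⟨h2, hq⟩, hmin⟩ := hF
  have hpn : ¬ p ∣ p ^ h - 1 := not_dvd_pow_sub_one hh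
  have hμ := exists_toC_eq_of_dvd hdvd
  obtain ⟨n, hn⟩ : ∃ n, p ^ h = n + 1 := ⟨p ^ h - 1, by lia⟩
  have hn' : p ^ h - 1 = n := by lia
  have hn0 : 0 < n := by lia
  rw [hn'] at hpn hμ
  have hG0 : PowerSeries.coeff 0 F.mulPi = 0 := by
    rw [PowerSeries.coeff_zero_eq_constantCoeff_apply]
    exact F.module.constantCoeff_act _
  have hG1 : PowerSeries.coeff 1 F.mulPi = π := F.module.coeff_one_act _
  obtain ⟨g, hg, hgn, hroot, htor⟩ := exists_eisenstein hπ hG0 hG1 hn0 (hn ▸ hq)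
    fun i hi hin => (PowerSeries.coeff i F.mulPi : O p K).2.lt_of_ne fun hi1 => by
      have : p ^ h ≤ i := hmin ⟨hi, hi1⟩
      lia
  obtain ⟨z, hgz⟩ := IsAlgClosed.exists_aeval_eq_zero (PadicAlgCl p) g fun h0 => by
    exact hn0.ne (natDegree_eq_of_degree_eq_some (n := 0) h0 ▸ hgn)
  obtain ⟨P, π', hπ', hPn, hP, hPz⟩ :=
    exists_radical_generator hπ hn0 hpn hg hgn hgz (hroot z hgz)
  have hadj : IntermediateField.adjoin K {P} = IntermediateField.adjoin K F.torsion := by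
    have htor : F.torsion = {z | z = 0 ∨ aeval z g = 0} := htor
    rw [htor]
    refine le_antisymm ?_ (IntermediateField.adjoin_le_iff.2 ?_)
    · rw [hPz]
      exact IntermediateField.adjoin.mono _ _ _ (Set.singleton_subset_iff.2 (Or.inr hgz))
    · rintro z' (rfl | hz')
      · exact zero_mem _
      · exact mem_adjoin_of_aeval_eq_zero hπ hn0 hμ hg hgn hgz (hroot z hgz) hz' hPn
          (hPz ▸ IntermediateField.mem_adjoin_simple_self K z)
  refine ⟨P, π', ?_, hπ', hn' ▸ hPn, hadj⟩
  rw [← hadj]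
  have hP1 := norm_lt_one_of_pow_eq ((isGenerator_iff π).1 hπ).1 hP
  refine ⟨⟨⟨P, IntermediateField.mem_adjoin_simple_self K P⟩, hP1.le⟩, rfl, ?_⟩
  rw [isGenerator_iff]
  exact ⟨hP1, fun y hy => norm_le_of_mem_adjoin hπ.hasValueGroup hπ.norm_pos
    ((isGenerator_iff π).1 hπ).1 hP (monic_X_pow_sub_C _ hn0.ne') natDegree_X_pow_sub_C hn0
    (aeval_X_pow_sub_C_eq_zero hPn) y.2 hy⟩

end Existence

/-! ### Unramified subextensions -/

section Unramified

/-- The extended ideal is spanned by the image of π, so the condition says that π still has the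
largest norm below 1. -/
theorem isUnramifiedExt_iff {E L : Type*} [Field E] [Field L] [Algebra E (PadicAlgCl p)]
    [Algebra L (PadicAlgCl p)] [Algebra E L] [IsScalarTower E L (PadicAlgCl p)] {π : O p E}
    (hπ : IsGenerator p π) :
    IsUnramifiedExt p E L ↔ ∀ x : L, ‖toC p x‖ < 1 → ‖toC p x‖ ≤ ‖toC p (π : E)‖ := by
  have hn : ‖toC p ((algebraMap (O p E) (O p L) π : O p L) : L)‖ = ‖toC p (π : E)‖ := by
    rw [Valuation.HasExtension.coe_algebraMap_valuationSubring_eq, toC,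
      ← IsScalarTower.algebraMap_apply]
  have h := isGenerator_iff (algebraMap (O p E) (O p L) π)
  rw [hn, and_iff_right ((isGenerator_iff π).1 hπ).1] at h
  rw [IsUnramifiedExt, hπ, Ideal.map_span, Set.image_singleton, eq_comm]
  exact h

theorem exists_norm_pow_sub_one_lt {x : PadicAlgCl p} (hx : ‖x‖ = 1) :
    ∃ m, ¬ p ∣ m ∧ ‖x ^ m - 1‖ < 1 := by
  have hint : IsIntegral ℚ_[p] x := Algebra.IsIntegral.isIntegral x
  let E := IntermediateField.adjoin ℚ_[p] {x}
  have : FiniteDimensional ℚ_[p] E := IntermediateField.adjoin.finiteDimensional hint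
  have := finite_residueField p E
  exact ⟨_, not_dvd_pow_sub_one (residueDegree_pos p E),
    norm_pow_sub_one_lt (x := (⟨x, IntermediateField.mem_adjoin_simple_self _ x⟩ : E)) hx⟩

variable {K : IntermediateField ℚ_[p] (PadicAlgCl p)}

/-- Residue classes of units that meet two algebraic extensions of `K` meet their intersection. -/
theorem exists_mem_inf_norm_sub_lt {L M : IntermediateField K (PadicAlgCl p)} {x c : PadicAlgCl p}
    (hx : x ∈ L) (hc : c ∈ M) (hx1 : ‖x‖ = 1) (hxc : ‖x - c‖ < 1) :
    ∃ y ∈ L ⊓ M, ‖x - y‖ < 1 := by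
  obtain ⟨m, hm, hxm⟩ := exists_norm_pow_sub_one_lt hx1
  have hm0 : m ≠ 0 := fun h0 => hm (h0 ▸ dvd_zero p)
  have hc1 : ‖c‖ = 1 := norm_eq_one_of_norm_sub_lt hx1 (by rwa [norm_sub_rev])
  have hcm : ‖c ^ m - 1‖ < 1 := norm_sub_lt_of_lt (y := x ^ m)
    (norm_pow_sub_pow_lt hc1.le hx1.le (by rwa [norm_sub_rev]) m) hxm
  -- Teichmüller representatives: x and c are congruent to m-th roots of unity w in L and v in M.
  -- These share a residue class, so they coincide and lie in L ⊓ M.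
  obtain ⟨w, hw, hwx⟩ := exists_pow_eq_of_norm_sub_lt (E := L) hm ⟨x, hx⟩ 1 hx1
    (by rw [toC, toC, map_one]; exact hxm)
  obtain ⟨v, hv, hvc⟩ := exists_pow_eq_of_norm_sub_lt (E := M) hm ⟨c, hc⟩ 1 hc1
    (by rw [toC, toC, map_one]; exact hcm)
  have hw' : toC p w ^ m = 1 := by rw [← toC_pow, hw, toC, map_one]
  have hv' : toC p v ^ m = 1 := by rw [← toC_pow, hv, toC, map_one]
  have hwx' : ‖toC p w - x‖ < 1 := hwx
  have hvc' : ‖toC p v - c‖ < 1 := hvc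
  have e : toC p w = toC p v := by
    refine eq_of_pow_eq_pow hm (norm_eq_one_of_pow_eq_one hm0 hv') (hw'.trans hv'.symm) ?_
    refine norm_sub_lt_of_lt hwx' (norm_sub_lt_of_lt hxc ?_)
    rwa [norm_sub_rev]
  refine ⟨toC p w, ⟨w.2, ?_⟩, by rwa [norm_sub_rev]⟩
  rw [e]
  exact v.2

/-- An unramified extension `L` of `K`, all of whose residue classes are represented in a finite
extension `M` of `K`, is contained in `M`. -/
theorem IsUnramifiedExt.le_of_forall_exists [FiniteDimensional ℚ_[p] K] {π : O p K}
    (hπ : IsGenerator p π) {L M : IntermediateField K (PadicAlgCl p)} [FiniteDimensional K M]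
    (hL : IsUnramifiedExt p K L) (hLM : ∀ x ∈ L, ‖x‖ = 1 → ∃ c ∈ M, ‖x - c‖ < 1) : L ≤ M := by
  have h0 := hπ.norm_pos
  have h1 := ((isGenerator_iff π).1 hπ).1
  have hπ0 : toC p (π : K) ≠ 0 := norm_pos_iff.1 h0
  have : FiniteDimensional ℚ_[p] M := FiniteDimensional.trans ℚ_[p] K M
  have hLn := (isUnramifiedExt_iff hπ).1 hL
  -- Taking y in L as well keeps x - y in L, where unramifiedness improves ‖x - y‖ < 1 to ‖x - y‖ ≤
  -- ‖π‖. Then (x - y)/π is integral in L and the step can be iterated.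
  have hstep : ∀ x ∈ L, ‖x‖ ≤ 1 → ∃ y ∈ L ⊓ M, ‖x - y‖ ≤ ‖toC p (π : K)‖ := by
    intro x hx hx1
    obtain ⟨y, hy, hxy⟩ : ∃ y ∈ L ⊓ M, ‖x - y‖ < 1 := by
      rcases hx1.lt_or_eq with hlt | heq
      · exact ⟨0, zero_mem _, by rwa [sub_zero]⟩
      · obtain ⟨c, hc, hxc⟩ := hLM x hx heq
        exact exists_mem_inf_norm_sub_lt hx hc heq hxc
    exact ⟨y, hy, hLn ⟨x - y, sub_mem hx hy.1⟩ hxy⟩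
  have happrox : ∀ (k : ℕ), ∀ x ∈ L, ‖x‖ ≤ 1 → ∃ y ∈ M, ‖x - y‖ ≤ ‖toC p (π : K)‖ ^ k := by
    intro k
    induction k with
    | zero => exact fun x _ hx1 => ⟨0, zero_mem _, by simpa using hx1⟩
    | succ k ih =>
      intro x hx hx1
      obtain ⟨y, hy, hxy⟩ := hstep x hx hx1
      obtain ⟨v, hv, hxv⟩ := ih ((x - y) / toC p (π : K))
        (div_mem (sub_mem hx hy.1) (L.algebraMap_mem _))
        (by rw [norm_div]; exact div_le_one_of_le₀ hxy h0.le)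
      refine ⟨y + toC p (π : K) * v, add_mem hy.2 (mul_mem (M.algebraMap_mem _) hv), ?_⟩
      have e : x - (y + toC p (π : K) * v) =
          toC p (π : K) * ((x - y) / toC p (π : K) - v) := by
        field_simp
        ring
      rw [e, norm_mul, pow_succ']
      exact mul_le_mul_of_nonneg_left hxv h0.le
  have hlim := tendsto_pow_atTop_nhds_zero_of_lt_one h0.le h1
  have hint : ∀ x ∈ L, ‖x‖ ≤ 1 → x ∈ M := by
    intro x hx hx1
    choose y hyM hy using fun k => happrox k x hx hx1
    have hclosed : IsClosed (rangeSubmodule p M : Set (PadicAlgCl p)) :=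
      isComplete_rangeSubmodule.isClosed
    have hty : Filter.Tendsto y Filter.atTop (nhds x) := by
      rw [tendsto_iff_norm_sub_tendsto_zero]
      exact squeeze_zero (fun _ => norm_nonneg _) (fun k => norm_sub_rev (y k) x ▸ hy k) hlim
    obtain ⟨w, rfl⟩ := mem_rangeSubmodule.1
      (hclosed.mem_of_tendsto hty (Filter.Eventually.of_forall fun k => ⟨⟨y k, hyM k⟩, rfl⟩))
    exact w.2
  intro x hx
  have hlim' : Filter.Tendsto (fun k : ℕ => ‖toC p (π : K)‖ ^ k * ‖x‖) Filter.atTop (nhds 0) := by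
    simpa using hlim.mul_const ‖x‖
  obtain ⟨k, hk⟩ := (hlim'.eventually_le_const one_pos).exists
  have hmem := hint (toC p (π : K) ^ k * x) (mul_mem (pow_mem (L.algebraMap_mem _) k) hx)
    (by rwa [norm_mul, norm_pow])
  have e : x = toC p (π : K) ^ k * x / toC p (π : K) ^ k := by field_simp
  rw [e]
  exact div_mem hmem (pow_mem (M.algebraMap_mem _) k)

end Unramified

/-! ### The compositum of two division fields -/

section Compositum

variable {K : IntermediateField ℚ_[p] (PadicAlgCl p)}

/-- Two radicals of generators of `𝔭_K` differ by a root of unity up to a factor in `K`. -/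
theorem exists_eq_mul_mul {n m : ℕ} (hn : 0 < n) (hpn : ¬ p ∣ n) (hm : m ≠ 0)
    (hμ : ∀ x : PadicAlgCl p, x ^ n = 1 → ∃ y : K, toC p y = x)
    (hμm : ∀ x : PadicAlgCl p, x ^ m = 1 → ∃ y : K, toC p y = x) {P₁ P₂ ζ ζ₁ : PadicAlgCl p}
    {a₁ a₂ : K} (ha₁ : a₁ ≠ 0) (ha₂ : a₂ ≠ 0) (hP₁ : P₁ ^ n = toC p a₁) (hP₂ : P₂ ^ n = toC p a₂)
    (hζ : ζ ^ m = 1) (hsub : ‖toC p a₂ / toC p a₁ - ζ‖ < 1) (hζ₁ : ζ₁ ^ n = ζ) :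
    ∃ k : K, k ≠ 0 ∧ P₂ = toC p k * (ζ₁ * P₁) := by
  have hζn := norm_eq_one_of_pow_eq_one hm hζ
  have hζ0 : ζ ≠ 0 := norm_ne_zero_iff.1 (hζn ▸ one_ne_zero)
  obtain ⟨y, rfl⟩ := hμm ζ hζ
  have h1K : toC p (1 : K) = 1 := map_one _
  have hb : toC p (a₂ / a₁ / y) = toC p a₂ / toC p a₁ / toC p y := by rw [toC_div, toC_div]
  -- The quotient a₂/(a₁ζ) is congruent to 1, hence an n-th power w^n in K. Then P₂/(w ζ₁ P₁) is an
  -- n-th root of unity, so it too lies in K.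
  obtain ⟨w, hw, hw1⟩ := exists_pow_eq_of_norm_sub_lt (E := K) hpn 1 (a₂ / a₁ / y)
    (by rw [h1K, norm_one])
    (by rw [h1K, one_pow, hb, norm_sub_rev, div_sub_one hζ0, norm_div, hζn, div_one]; exact hsub)
  rw [h1K] at hw1
  have hw0 : toC p w ≠ 0 := norm_ne_zero_iff.1 (by
    rw [norm_eq_one_of_norm_sub_lt norm_one hw1]
    exact one_ne_zero)
  have hwn : toC p w ^ n = toC p a₂ / toC p a₁ / toC p y := by rw [← toC_pow, hw, hb]
  have ha₁' := toC_ne_zero (p := p) ha₁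
  have ha₂' := toC_ne_zero (p := p) ha₂
  have hζ₁0 : ζ₁ ≠ 0 := fun h => hζ0 (by rw [← hζ₁, h, zero_pow hn.ne'])
  have hP₁0 : P₁ ≠ 0 := fun h => ha₁' (by rw [← hP₁, h, zero_pow hn.ne'])
  have hP₂0 : P₂ ≠ 0 := fun h => ha₂' (by rw [← hP₂, h, zero_pow hn.ne'])
  obtain ⟨v, hv⟩ := hμ (P₂ / (toC p w * (ζ₁ * P₁))) (by
    rw [div_pow, mul_pow, mul_pow, hwn, hζ₁, hP₁, hP₂]
    field_simp)
  have e : P₂ = toC p (v * w) * (ζ₁ * P₁) := by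
    rw [toC_mul, hv]
    field_simp
  refine ⟨v * w, fun h => hP₂0 ?_, e⟩
  rw [e, h, toC_zero, zero_mul]

theorem adjoin_pair_eq_of_eq_mul {F E : Type*} [Field F] [Field E] [Algebra F E] {x y a : E} {k : F}
    (hk : k ≠ 0) (ha : a ≠ 0) (h : y = algebraMap F E k * (x * a)) :
    IntermediateField.adjoin F {a, y} = IntermediateField.adjoin F {x, a} := by
  have hk' : algebraMap F E k ≠ 0 := (_root_.map_ne_zero _).2 hk
  refine le_antisymm (IntermediateField.adjoin_le_iff.2 ?_) (IntermediateField.adjoin_le_iff.2 ?_)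
  · have hx : x ∈ IntermediateField.adjoin F {x, a} := IntermediateField.subset_adjoin _ _ (by simp)
    have ha : a ∈ IntermediateField.adjoin F {x, a} := IntermediateField.subset_adjoin _ _ (by simp)
    rintro z (rfl | rfl)
    · exact ha
    · rw [h]
      exact mul_mem (IntermediateField.algebraMap_mem _ k) (mul_mem hx ha)
  · have ha' : a ∈ IntermediateField.adjoin F {a, y} :=
      IntermediateField.subset_adjoin _ _ (by simp)
    have hy : y ∈ IntermediateField.adjoin F {a, y} := IntermediateField.subset_adjoin _ _ (by simp)
    rintro z (rfl | rfl)
    · have e : z = y / algebraMap F E k / a := by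
        rw [h]
        field_simp
      rw [e]
      exact div_mem (div_mem hy (IntermediateField.algebraMap_mem _ k)) ha'
    · exact ha'

/-- K(ζ₁) keeps the value group of K, hence is unramified. Over it, P is an n-th root of an element
whose norm generates that value group, so every residue class of K(ζ₁, P) is represented in K(ζ₁).
-/
theorem isGreatest_unramified [FiniteDimensional ℚ_[p] K] {π : O p K} (hπ : IsGenerator p π) {n N : ℕ} (hn : 0 < n)
    (hN : ¬ p ∣ N) {ζ₁ P : PadicAlgCl p} (hζ₁ : ζ₁ ^ N = 1) (hP : P ^ n = toC p (π : K)) :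
    IsGreatest {L : IntermediateField K (PadicAlgCl p) |
      L ≤ IntermediateField.adjoin K {ζ₁, P} ∧ IsUnramifiedExt p K L}
      (IntermediateField.adjoin K {ζ₁}) := by
  have h0 := hπ.norm_pos
  have h1 := ((isGenerator_iff π).1 hπ).1
  have hPn : ‖P‖ ^ n = ‖toC p (π : K)‖ := by rw [← norm_pow, hP]
  have hval := hπ.hasValueGroup.adjoin_root_of_unity hN hζ₁
  refine ⟨⟨IntermediateField.adjoin.mono _ _ _ (by simp), (isUnramifiedExt_iff hπ).2
    fun x hx => hval.norm_le h0 h1 hx⟩, fun L hL => ?_⟩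
  have hint : IsIntegral K ζ₁ := Algebra.IsIntegral.isIntegral ζ₁
  have := IntermediateField.adjoin.finiteDimensional hint
  refine hL.2.le_of_forall_exists hπ fun x hx hx1 => ?_
  have hxM := hL.1 hx
  rw [← IntermediateField.adjoin_simple_adjoin_simple, IntermediateField.mem_restrictScalars] at hxM
  have hP' : P ^ n = toC p (algebraMap K (IntermediateField.adjoin K {ζ₁}) π) := hP
  obtain ⟨c, hc⟩ := exists_norm_sub_le hval h0 h1 hPn (monic_X_pow_sub_C _ hn.ne')
    natDegree_X_pow_sub_C hn (aeval_X_pow_sub_C_eq_zero hP') hxM hx1.le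
  exact ⟨toC p c, c.2, hc.trans_lt (norm_lt_one_of_pow_eq h1 hPn)⟩

end Compositum

end PadicTorsion

end

/-! ### The main theorem -/

theorem corollary2p2 (p : ℕ) [Fact p.Prime] (hp : p ≠ 2)
    (K : IntermediateField ℚ_[p] (PadicAlgCl p)) [FiniteDimensional ℚ_[p] K]
    (π₁ π₂ : PadicTorsion.O p K)
    (hπ₁ : PadicTorsion.IsGenerator p π₁) (hπ₂ : PadicTorsion.IsGenerator p π₂)
    (F₁ : PadicTorsion.UnramifiedGroupLaw p K π₁) (F₂ : PadicTorsion.UnramifiedGroupLaw p K π₂)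
    (h : ℕ) (hF₁ : F₁.HasHeight h) (hF₂ : F₂.HasHeight h)
    (hdvd : h ∣ PadicTorsion.residueDegree p ℚ_[p] K) :
    (∃ P₁ π₁', F₁.IsAdmissiblePair (p ^ h) P₁ π₁') ∧
    (∃ P₂ π₂', F₂.IsAdmissiblePair (p ^ h) P₂ π₂') ∧
    ∀ (P₁ P₂ : PadicAlgCl p) (π₁' π₂' : PadicTorsion.O p K),
      F₁.IsAdmissiblePair (p ^ h) P₁ π₁' → F₂.IsAdmissiblePair (p ^ h) P₂ π₂' →
      ∀ ζ ζ₁ : PadicAlgCl p,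
        ζ ^ (p ^ PadicTorsion.residueDegree p ℚ_[p] K - 1) = 1 →
        ‖PadicTorsion.toC p (π₂' : K) / PadicTorsion.toC p (π₁' : K) - ζ‖ < 1 →
        ζ₁ ^ (p ^ h - 1) = ζ →
        (IntermediateField.adjoin K (F₁.torsion ∪ F₂.torsion) =
            IntermediateField.adjoin K {P₁, P₂} ∧
          IntermediateField.adjoin K {P₁, P₂} = IntermediateField.adjoin K {ζ₁, P₁} ∧
          IntermediateField.adjoin K {ζ₁, P₁} = IntermediateField.adjoin K {ζ₁, P₂}) ∧
        IsGreatest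
          {L : IntermediateField K (PadicAlgCl p) |
            L ≤ IntermediateField.adjoin K (F₁.torsion ∪ F₂.torsion) ∧
              PadicTorsion.IsUnramifiedExt p K L}
          (IntermediateField.adjoin K {ζ₁}) := by
  have := PadicTorsion.finite_residueField p K
  refine ⟨hF₁.exists_isAdmissiblePair hπ₁ hdvd, hF₂.exists_isAdmissiblePair hπ₂ hdvd,
    fun P₁ P₂ π₁' π₂' h₁ h₂ ζ ζ₁ hζ hsub hζ₁ => ?_⟩
  have hpn : ¬ p ∣ p ^ h - 1 := PadicTorsion.not_dvd_pow_sub_one hF₁.1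
  have hn : 0 < p ^ h - 1 := Nat.pos_of_ne_zero fun h0 => hpn (h0 ▸ dvd_zero p)
  have hpm := PadicTorsion.not_dvd_pow_sub_one (p := p) (PadicTorsion.residueDegree_pos p K)
  have hne : ∀ {π : PadicTorsion.O p K}, PadicTorsion.IsGenerator p π → (π : K) ≠ 0 :=
    fun hπ h0 => norm_pos_iff.1 hπ.norm_pos (by rw [h0, PadicTorsion.toC_zero])
  have hm0 : p ^ PadicTorsion.residueDegree p ℚ_[p] K - 1 ≠ 0 := fun h0 => hpm (h0 ▸ dvd_zero p)
  obtain ⟨k, hk, hP⟩ := PadicTorsion.exists_eq_mul_mul hn hpn hm0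
    (PadicTorsion.exists_toC_eq_of_dvd hdvd) (PadicTorsion.exists_toC_eq_of_dvd dvd_rfl)
    (hne h₁.generator_base) (hne h₂.generator_base) h₁.pow_eq h₂.pow_eq hζ hsub hζ₁
  have hP₁0 : P₁ ≠ 0 := fun h0 => PadicTorsion.toC_ne_zero (p := p) (hne h₁.generator_base) (by
    rw [← h₁.pow_eq, h0, zero_pow hn.ne'])
  -- Both factors of this exponent are prime to p, so ζ₁ is a root of unity of order prime to p.
  have hζ₁N : ζ₁ ^ ((p ^ h - 1) * (p ^ PadicTorsion.residueDegree p ℚ_[p] K - 1)) = 1 := by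
    rw [pow_mul, hζ₁, hζ]
  have hζ₁0 : ζ₁ ≠ 0 := fun h0 => by
    rw [h0, zero_pow (mul_ne_zero hn.ne' hm0)] at hζ₁N
    exact zero_ne_one hζ₁N
  have e₁ : IntermediateField.adjoin K (F₁.torsion ∪ F₂.torsion) =
      IntermediateField.adjoin K {P₁, P₂} := by
    rw [IntermediateField.adjoin_union, ← h₁.adjoin_eq, ← h₂.adjoin_eq,
      ← IntermediateField.adjoin_union, Set.singleton_union]
  have e₂ : IntermediateField.adjoin K {P₁, P₂} = IntermediateField.adjoin K {ζ₁, P₁} :=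
    PadicTorsion.adjoin_pair_eq_of_eq_mul hk hP₁0 hP
  -- The relation P₂ = k ζ₁ P₁ is used again with the roles of ζ₁ and P₁ exchanged.
  have e₃ : IntermediateField.adjoin K {ζ₁, P₂} = IntermediateField.adjoin K {P₁, ζ₁} :=
    PadicTorsion.adjoin_pair_eq_of_eq_mul hk hζ₁0 (by rw [hP, mul_comm ζ₁])
  refine ⟨⟨e₁, e₂, by rw [e₃, Set.pair_comm]⟩, ?_⟩
  rw [e₁, e₂]
  refine PadicTorsion.isGreatest_unramified h₁.generator_base hn ?_ hζ₁N h₁.pow_eq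
  exact fun hd => ((Nat.Prime.dvd_mul Fact.out).1 hd).elim hpn hpm
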